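/- Let $X$ be a topological space, $\mathbf K=\mathbf R$ or $\mathbf C$, and $(\mathcal A,d,\Omega^1)$ a differential triad on $X$: $\mathcal A$ is a sheaf of unital, commutative, associative $\mathbf K$-algebras, $\Omega^1$ is an $\mathcal A$-module, and $d:\mathcal A\to\Omega^1$ is a $\mathbf K$-linear morphism of sheaves with $d(st)=s\,d(t)+t\,d(s)$. Let $\mathcal G$ be a sheaf of groups of Lie type: it is equipped with a representation $\varrho:\mathcal G\to\mathcal Aut(\mathcal L)$ in an $\mathcal A$-module of Lie algebras $\mathcal L$, and with a morphism of sheaves of sets $\partial:\mathcal G\to\Omega^1\otimes_{\mathcal A}\mathcal L$ such that $\partial(s\cdot t)=\varrho(t^{-1}).\partial(s)+\partial(t)$, where $\varrho(g).\omega:=(1\otimes\varrho(g))(\omega)$. Let $\mathcal P$ be a principal sheaf over $X$ with structure sheaf $\mathcal G$, i.e. a sheaf of sets with a right $\mathcal G$-action that is locally $\mathcal G$-equivariantly isomorphic to $\mathcal G$. Let $n\ge 0$ and let $\varphi:\mathcal G\to\mathcal{GL}(n,\mathcal A)$ be a morphism of sheaves of groups which is of Lie type by means of a morphism of sheaves of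 $\mathcal A$-Lie algebras $\overline\varphi:\mathcal L\to M_n(\mathcal A)$, that is, $$\widetilde\partial\circ\varphi=(1\otimes\overline\varphi)\circ\partial,\qquad \overline\varphi\circ\varrho(g)=\mathrm{Ad}(\varphi(g))\circ\overline\varphi\quad(g\in\mathcal G),$$ where $\widetilde\partial(a)=a^{-1}\cdot(da_{ij})\in\Omega^1\otimes_{\mathcal A}M_n(\mathcal A)$ and $\mathrm{Ad}(a)(m)=a\,m\,a^{-1}$. Let $\mathcal E$ be the vector sheaf associated with $\mathcal P$ by $\varphi$: the sheaf generated by the presheaf $U\mapsto(\mathcal P(U)\times\mathcal A^n(U))/\mathcal G(U)$, where $(s,a)\sim(s\cdot g,\varphi(g^{-1})\cdot a)$, with the $\mathcal A$-module structure for which all the maps $a\mapsto[s,a]$ are $\mathcal A$-linear. A connection on $\mathcal P$ is a morphism of sheaves of sets $D:\mathcal P\to\Omega^1\otimes_{\mathcal A}\mathcal L$ with $D(s\cdot g)=\varrho(g^{-1}).D(s)+\partial(g)$. An $\mathcal A$-linear connection on $\mathcal E$ is a $\mathbf K$-linear morphism of sheaves $\nabla:\mathcal E\to\mathcal E\otimes_{\mathcal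 A}\Omega^1$ with $\nabla(a\,s)=a\nabla(s)+s\otimes d(a)$. If $\overline\varphi$ is an isomorphism, then there is a unique bijection $D\mapsto\nabla$ from the connections on $\mathcal P$ onto the $\mathcal A$-linear connections on $\mathcal E$ with the following property: for every local section $s\in\mathcal P(U)$, with $e_j:=[s,(0,\dots,1,\dots,0)]\in\mathcal E(U)$ (the $1$ in the $j$-th entry), one has $\nabla(e_j)=\sum_i e_i\otimes\theta_{ij}$, where $(\theta_{ij})\in M_n(\Omega^1(U))\cong(\Omega^1\otimes_{\mathcal A}M_n(\mathcal A))(U)$ is the matrix corresponding to $(1\otimes\overline\varphi)(D(s))$. -/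

import Mathlib

open CategoryTheory Opposite TopologicalSpace
open scoped TensorProduct

universe u v

namespace AssocSheaf

/-! ### Sheaves of rings and of modules, through their sections -/

section Basic

variable {X : TopCat.{u}}

/-- Sections over `U` of a sheaf of commutative rings. -/
abbrev RSec (A : X.Sheaf CommRingCat.{u}) (U : Opens X) : Type u := A.1.obj (op U)

/-- Sections over `U` of a sheaf of groups. -/
abbrev GSec (G : X.Sheaf GrpCat.{u}) (U : Opens X) : Type u := G.1.obj (op U)

/-- Sections over `U` of a sheaf of sets. -/
abbrev SSec (P : X.Sheaf (Type u)) (U : Opens X) : Type u := P.1.obj (op U)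

/-- Restriction of sections of a sheaf of commutative rings. -/
def rres (A : X.Sheaf CommRingCat.{u}) {U V : Opens X} (h : V ≤ U) : RSec A U →+* RSec A V :=
  (A.1.map (homOfLE h).op).hom

/-- Restriction of sections of a sheaf of groups. -/
def gres (G : X.Sheaf GrpCat.{u}) {U V : Opens X} (h : V ≤ U) : GSec G U →* GSec G V :=
  (G.1.map (homOfLE h).op).hom

/-- Restriction of sections of a sheaf of sets. -/
def sres (P : X.Sheaf (Type u)) {U V : Opens X} (h : V ≤ U) : SSec P U → SSec P V :=
  fun s => P.1.map (homOfLE h).op s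

/-- Restriction of sections of a presheaf of abelian groups. -/
def ares (F : X.Presheaf AddCommGrpCat.{u}) {U V : Opens X} (h : V ≤ U) :
    F.obj (op U) →+ F.obj (op V) :=
  (F.map (homOfLE h).op).hom

lemma rres_self (A : X.Sheaf CommRingCat.{u}) {U : Opens X} (h : U ≤ U) (a : RSec A U) :
    rres A h a = a := by
  simp [rres]

lemma rres_rres (A : X.Sheaf CommRingCat.{u}) {U V W : Opens X} (h : V ≤ U) (k : W ≤ V)
    (a : RSec A U) : rres A k (rres A h a) = rres A (k.trans h) a := by
  have : (homOfLE (k.trans h)).op = (homOfLE h).op ≫ (homOfLE k).op := rfl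
  simp [rres, this]

lemma gres_self (G : X.Sheaf GrpCat.{u}) {U : Opens X} (h : U ≤ U) (a : GSec G U) :
    gres G h a = a := by
  simp [gres]

lemma gres_gres (G : X.Sheaf GrpCat.{u}) {U V W : Opens X} (h : V ≤ U) (k : W ≤ V)
    (a : GSec G U) : gres G k (gres G h a) = gres G (k.trans h) a := by
  have : (homOfLE (k.trans h)).op = (homOfLE h).op ≫ (homOfLE k).op := rfl
  simp [gres, this]

lemma sres_self (P : X.Sheaf (Type u)) {U : Opens X} (h : U ≤ U) (a : SSec P U) :
    sres P h a = a := by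
  simp [sres]

lemma sres_sres (P : X.Sheaf (Type u)) {U V W : Opens X} (h : V ≤ U) (k : W ≤ V)
    (a : SSec P U) : sres P k (sres P h a) = sres P (k.trans h) a := by
  have : (homOfLE (k.trans h)).op = (homOfLE h).op ≫ (homOfLE k).op := rfl
  simp [sres, this]

lemma ares_self (F : X.Presheaf AddCommGrpCat.{u}) {U : Opens X} (h : U ≤ U) (a : F.obj (op U)) :
    ares F h a = a := by
  simp [ares]

lemma ares_ares (F : X.Presheaf AddCommGrpCat.{u}) {U V W : Opens X} (h : V ≤ U) (k : W ≤ V)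
    (a : F.obj (op U)) : ares F k (ares F h a) = ares F (k.trans h) a := by
  have : (homOfLE (k.trans h)).op = (homOfLE h).op ≫ (homOfLE k).op := rfl
  simp [ares, this]

/-- A presheaf of modules over the sheaf of commutative rings `A`: a presheaf of abelian groups
with an `A(U)`-module structure on the sections over each `U`, compatible with restriction. -/
structure PreMod (A : X.Sheaf CommRingCat.{u}) where
  /-- the underlying presheaf of abelian groups -/
  ab : X.Presheaf AddCommGrpCat.{u}
  [module : ∀ U : Opens X, Module (RSec A U) (ab.obj (op U))]
  ares_smul : ∀ {U V : Opens X} (h : V ≤ U) (a : RSec A U) (m : ab.obj (op U)),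
    ares ab h (a • m) = rres A h a • ares ab h m

attribute [instance] PreMod.module

/-- Sections over `U` of a presheaf of modules. -/
abbrev PreMod.Sec {A : X.Sheaf CommRingCat.{u}} (M : PreMod A) (U : Opens X) : Type u :=
  M.ab.obj (op U)

/-- Restriction of sections of a presheaf of modules. -/
abbrev PreMod.res {A : X.Sheaf CommRingCat.{u}} (M : PreMod A) {U V : Opens X} (h : V ≤ U) :
    M.Sec U →+ M.Sec V := ares M.ab h

/-- An `A`-module: a presheaf of modules whose underlying presheaf is a sheaf. -/
structure ShMod (A : X.Sheaf CommRingCat.{u}) extends PreMod A where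
  isSheaf : TopCat.Presheaf.IsSheaf ab

/-- The presheaf of modules with prescribed modules of sections `S U` and restrictions `r`. -/
def PreMod.ofSections (A : X.Sheaf CommRingCat.{u}) (S : Opens X → Type u)
    [∀ U, AddCommGroup (S U)] [inst : ∀ U, Module (RSec A U) (S U)]
    (r : ∀ {U V : Opens X}, V ≤ U → S U →+ S V)
    (r_self : ∀ {U : Opens X} (h : U ≤ U) (m : S U), r h m = m)
    (r_r : ∀ {U V W : Opens X} (h : V ≤ U) (k : W ≤ V) (m : S U),
      r k (r h m) = r (k.trans h) m)
    (r_smul : ∀ {U V : Opens X} (h : V ≤ U) (a : RSec A U) (m : S U),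
      r h (a • m) = rres A h a • r h m) : PreMod A where
  ab :=
    { obj := fun U => AddCommGrpCat.of (S U.unop)
      map := fun f => AddCommGrpCat.ofHom (r (leOfHom f.unop))
      map_id := fun _ => AddCommGrpCat.hom_ext (AddMonoidHom.ext (r_self _))
      map_comp := fun f g => AddCommGrpCat.hom_ext
        (AddMonoidHom.ext fun m => (r_r (leOfHom f.unop) (leOfHom g.unop) m).symm) }
  module := inst
  ares_smul := r_smul

/-! ### Sheafification: local description of sections, and extension of local operations -/

/-- The sheaf of abelian groups generated by a presheaf of abelian groups. -/
noncomputable abbrev shf (T : X.Presheaf AddCommGrpCat.{u}) : X.Sheaf AddCommGrpCat.{u} :=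
  (presheafToSheaf (Opens.grothendieckTopology X) AddCommGrpCat.{u}).obj T

/-- The canonical map from a presheaf to the sheaf it generates, on sections. -/
noncomputable def toShf (T : X.Presheaf AddCommGrpCat.{u}) {U : Opens X} :
    T.obj (op U) →+ (shf T).1.obj (op U) :=
  ((toSheafify (Opens.grothendieckTopology X) T).app (op U)).hom

lemma ares_toShf (T : X.Presheaf AddCommGrpCat.{u}) {U V : Opens X} (h : V ≤ U)
    (t : T.obj (op U)) : ares (shf T).1 h (toShf T t) = toShf T (ares T h t) := by
  have := (toSheafify (Opens.grothendieckTopology X) T).naturality (homOfLE h).op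
  exact (congr($(this).hom t)).symm

lemma toShf_locally_inj (T : X.Presheaf AddCommGrpCat.{u}) {U : Opens X} (s t : T.obj (op U))
    (hst : toShf T s = toShf T t) (x : X) (hx : x ∈ U) :
    ∃ (V : Opens X) (h : V ≤ U), x ∈ V ∧ ares T h s = ares T h t := by
  obtain ⟨V, f, hf, hV⟩ := Presheaf.equalizerSieve_mem (Opens.grothendieckTopology X)
    (toSheafify (Opens.grothendieckTopology X) T) s t hst x hx
  exact ⟨V, leOfHom f, hV, hf⟩

lemma toShf_locally_surj (T : X.Presheaf AddCommGrpCat.{u}) {U : Opens X}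
    (y : (shf T).1.obj (op U)) (x : X) (hx : x ∈ U) :
    ∃ (V : Opens X) (h : V ≤ U), x ∈ V ∧ ∃ t, toShf T t = ares (shf T).1 h y := by
  obtain ⟨V, f, hf, hV⟩ := Presheaf.imageSieve_mem (Opens.grothendieckTopology X)
    (toSheafify (Opens.grothendieckTopology X) T) y x hx
  exact ⟨V, leOfHom f, hV, hf⟩

lemma ab_ext {F : X.Presheaf AddCommGrpCat.{u}} (hF : F.IsSheaf) {U : Opens X}
    (s t : F.obj (op U)) (h : ∀ x ∈ U, ∃ (V : Opens X) (hV : V ≤ U), x ∈ V ∧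
      ares F hV s = ares F hV t) : s = t :=
  hF.section_ext fun x hx => by
    obtain ⟨V, hV, hxV, e⟩ := h x hx
    exact ⟨V, hV, hxV, e⟩

/-- Gluing in a sheaf of abelian groups, for a family indexed by pairs `(V, i)` with `V ≤ U`. -/
lemma ab_glue {F : X.Presheaf AddCommGrpCat.{u}} (hF : F.IsSheaf) {U : Opens X}
    {ι : Type u} (V : ι → Opens X) (hV : ∀ i, V i ≤ U) (hc : ∀ x ∈ U, ∃ i, x ∈ V i)
    (f : ∀ i, F.obj (op (V i)))
    (hf : ∀ i j, ares F (inf_le_left : V i ⊓ V j ≤ V i) (f i) =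
      ares F (inf_le_right : V i ⊓ V j ≤ V j) (f j)) :
    ∃! y : F.obj (op U), ∀ i, ares F (hV i) y = f i :=
  TopCat.Sheaf.existsUnique_gluing' ⟨F, hF⟩ V U (fun i => homOfLE (hV i))
    (fun x hx => by obtain ⟨i, hi⟩ := hc x hx; exact Opens.mem_iSup.2 ⟨i, hi⟩) f hf

/-- A natural family of maps `m V : T(V) → F(V)`, `V ≤ U`, into a sheaf `F` extends uniquely to
sections over `U` of the sheaf generated by `T`. -/
lemma exists_unique_extend {T F : X.Presheaf AddCommGrpCat.{u}} (hF : F.IsSheaf) {U : Opens X}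
    (m : ∀ V : Opens X, V ≤ U → T.obj (op V) → F.obj (op V))
    (hm : ∀ (V W : Opens X) (h : V ≤ U) (k : W ≤ V) (t : T.obj (op V)),
      ares F k (m V h t) = m W (k.trans h) (ares T k t)) (x : (shf T).1.obj (op U)) :
    ∃! y : F.obj (op U), ∀ (V : Opens X) (h : V ≤ U) (t : T.obj (op V)),
      toShf T t = ares (shf T).1 h x → ares F h y = m V h t := by
  let ι := {i : Σ V : Opens X, T.obj (op V) //
    ∃ h : i.1 ≤ U, toShf T i.2 = ares (shf T).1 h x}
  obtain ⟨y, hy, huy⟩ := ab_glue hF (ι := ι) (fun i => i.1.1) (fun i => i.2.1)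
    (fun z hz => by
      obtain ⟨V, h, hzV, t, ht⟩ := toShf_locally_surj T x z hz
      exact ⟨⟨⟨V, t⟩, h, ht⟩, hzV⟩)
    (fun i => m i.1.1 i.2.1 i.1.2)
    (by
      rintro ⟨⟨V, t⟩, h, ht⟩ ⟨⟨V', t'⟩, h', ht'⟩
      dsimp only at h ht h' ht' ⊢
      rw [hm, hm]
      refine ab_ext hF _ _ fun z hz => ?_
      obtain ⟨W, hW, hzW, e⟩ := toShf_locally_inj T (ares T inf_le_left t)
        (ares T inf_le_right t') (by
          rw [← ares_toShf, ← ares_toShf, ht, ht', ares_ares, ares_ares]) z hz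
      exact ⟨W, hW, hzW, by rw [hm, hm, e]⟩)
  exact ⟨y, fun V h t ht => hy ⟨⟨V, t⟩, h, ht⟩, fun y' h' => huy y' fun i => h' _ _ _ i.2.2⟩

/-- The extension of a natural family of maps `m V : T(V) → F(V)`, `V ≤ U`, to the sections over
`U` of the sheaf generated by `T`. -/
noncomputable def extend {T F : X.Presheaf AddCommGrpCat.{u}} (hF : F.IsSheaf) {U : Opens X}
    (m : ∀ V : Opens X, V ≤ U → T.obj (op V) → F.obj (op V))
    (hm : ∀ (V W : Opens X) (h : V ≤ U) (k : W ≤ V) (t : T.obj (op V)),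
      ares F k (m V h t) = m W (k.trans h) (ares T k t)) (x : (shf T).1.obj (op U)) :
    F.obj (op U) :=
  (exists_unique_extend hF m hm x).choose

lemma extend_spec {T F : X.Presheaf AddCommGrpCat.{u}} (hF : F.IsSheaf) {U : Opens X}
    (m : ∀ V : Opens X, V ≤ U → T.obj (op V) → F.obj (op V))
    (hm : ∀ (V W : Opens X) (h : V ≤ U) (k : W ≤ V) (t : T.obj (op V)),
      ares F k (m V h t) = m W (k.trans h) (ares T k t)) (x : (shf T).1.obj (op U))
    (V : Opens X) (h : V ≤ U) (t : T.obj (op V)) (ht : toShf T t = ares (shf T).1 h x) :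
    ares F h (extend hF m hm x) = m V h t :=
  (exists_unique_extend hF m hm x).choose_spec.1 V h t ht

/-- Two sections over `U` of a sheaf agree if they agree wherever the given section of `shf T` comes
from a section of `T`. -/
lemma ext_of_shf {T F : X.Presheaf AddCommGrpCat.{u}} (hF : F.IsSheaf) {U : Opens X}
    (x : (shf T).1.obj (op U)) (y z : F.obj (op U))
    (h : ∀ (V : Opens X) (h : V ≤ U) (t : T.obj (op V)),
      toShf T t = ares (shf T).1 h x → ares F h y = ares F h z) : y = z :=
  ab_ext hF _ _ fun p hp => by
    obtain ⟨V, hV, hpV, t, ht⟩ := toShf_locally_surj T x p hp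
    exact ⟨V, hV, hpV, h V hV t ht⟩

/-- Scalar multiplication by `a ∈ A(U)` on the sections over `U` of the sheaf generated by a presheaf
of modules: it sends the class of a section `t` over `V ≤ U` to the class of `a|_V • t`. -/
noncomputable def PreMod.shSmul {A : X.Sheaf CommRingCat.{u}} (T : PreMod A) {U : Opens X}
    (a : RSec A U) (x : (shf T.ab).1.obj (op U)) : (shf T.ab).1.obj (op U) :=
  extend (shf T.ab).2 (fun V h t => toShf T.ab (rres A h a • t))
    (fun V W h k t => by rw [ares_toShf, T.ares_smul, rres_rres]) x

lemma PreMod.ares_shSmul {A : X.Sheaf CommRingCat.{u}} (T : PreMod A) {U : Opens X}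
    (a : RSec A U) (x : (shf T.ab).1.obj (op U)) (V : Opens X) (h : V ≤ U) (t : T.Sec V)
    (ht : toShf T.ab t = ares (shf T.ab).1 h x) :
    ares (shf T.ab).1 h (T.shSmul a x) = toShf T.ab (rres A h a • t) :=
  extend_spec _ _ _ x V h t ht

/-- The module structure on the sections of the sheaf generated by a presheaf of modules. -/
noncomputable abbrev PreMod.shModule {A : X.Sheaf CommRingCat.{u}} (T : PreMod A) (U : Opens X) :
    Module (RSec A U) ((shf T.ab).1.obj (op U)) where
  smul := T.shSmul
  one_smul := fun x => ext_of_shf (shf T.ab).2 x _ _ fun V h t ht => by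
    change ares _ h (T.shSmul _ _) = _
    rw [T.ares_shSmul _ _ V h t ht, map_one, one_smul, ht]
  mul_smul := fun a b x => ext_of_shf (shf T.ab).2 x _ _ fun V h t ht => by
    change ares _ h (T.shSmul _ _) = ares _ h (T.shSmul _ (T.shSmul _ _))
    rw [T.ares_shSmul _ _ V h t ht,
      T.ares_shSmul _ _ V h _ (T.ares_shSmul _ _ V h t ht).symm, map_mul, mul_smul]
  smul_zero := fun a => ext_of_shf (shf T.ab).2 (0 : (shf T.ab).1.obj (op U)) _ _
    fun V h t ht => by
      change ares _ h (T.shSmul _ _) = _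
      rw [T.ares_shSmul _ _ V h 0 (by rw [map_zero, map_zero]), smul_zero, map_zero, map_zero]
  smul_add := fun a x y => ext_of_shf (shf T.ab).2 x _ _ fun V h t ht => by
    refine ext_of_shf (shf T.ab).2 (ares (shf T.ab).1 h y) _ _ fun W k s hs => ?_
    change ares _ _ (ares _ h (T.shSmul _ _)) = ares _ _ (ares _ h (T.shSmul _ _ + T.shSmul _ _))
    rw [ares_ares] at hs
    rw [ares_ares, ares_ares]
    have ht' : toShf T.ab (T.res k t) = ares (shf T.ab).1 (k.trans h) x := by
      rw [← ares_toShf, ht, ares_ares]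
    rw [map_add, T.ares_shSmul _ _ W _ _ ht', T.ares_shSmul _ _ W _ _ hs,
      T.ares_shSmul _ _ W _ (T.res k t + s) (by rw [map_add, map_add, ht', hs]), smul_add, map_add]
  add_smul := fun a b x => ext_of_shf (shf T.ab).2 x _ _ fun V h t ht => by
    change ares _ h (T.shSmul _ _) = ares _ h (T.shSmul _ _ + T.shSmul _ _)
    rw [map_add (ares _ h), T.ares_shSmul _ _ V h t ht, T.ares_shSmul _ _ V h t ht,
      T.ares_shSmul _ _ V h t ht, map_add, add_smul, map_add]
  zero_smul := fun x => ext_of_shf (shf T.ab).2 x _ _ fun V h t ht => by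
    change ares _ h (T.shSmul _ _) = _
    rw [T.ares_shSmul _ _ V h t ht, map_zero, zero_smul, map_zero, map_zero]

lemma PreMod.ares_shSmul' {A : X.Sheaf CommRingCat.{u}} (T : PreMod A) {U V : Opens X} (h : V ≤ U)
    (a : RSec A U) (x : (shf T.ab).1.obj (op U)) :
    ares (shf T.ab).1 h (T.shSmul a x) = T.shSmul (rres A h a) (ares (shf T.ab).1 h x) := by
  refine ext_of_shf (shf T.ab).2 (ares (shf T.ab).1 h x) _ _ fun W k t ht => ?_
  rw [T.ares_shSmul _ _ W k t ht]
  rw [ares_ares] at ht ⊢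
  rw [T.ares_shSmul _ _ W _ t ht, rres_rres]

/-- The sheaf of modules generated by a presheaf of modules. -/
noncomputable def PreMod.sheafify {A : X.Sheaf CommRingCat.{u}} (T : PreMod A) : ShMod A where
  ab := (shf T.ab).1
  isSheaf := (shf T.ab).2
  module := T.shModule
  ares_smul := T.ares_shSmul'

/-- The canonical map from a presheaf of modules to the sheaf it generates. -/
noncomputable def PreMod.toSheafify {A : X.Sheaf CommRingCat.{u}} (T : PreMod A) {U : Opens X} :
    T.Sec U →ₗ[RSec A U] T.sheafify.Sec U where
  toFun := toShf T.ab
  map_add' := map_add _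
  map_smul' a t := by
    have := T.ares_shSmul a (toShf T.ab t) U le_rfl t (ares_self _ _ _).symm
    rw [ares_self, rres_self] at this
    exact this.symm

end Basic

/-! ### Tensor products -/

section Tensor

variable {X : TopCat.{u}} {A : X.Sheaf CommRingCat.{u}}

/-- Restriction `M(U) ⊗ N(U) → M(V) ⊗ N(V)`. -/
noncomputable def tres (M N : PreMod A) {U V : Opens X} (h : V ≤ U) :
    M.Sec U ⊗[RSec A U] N.Sec U →+ M.Sec V ⊗[RSec A V] N.Sec V :=
  TensorProduct.liftAddHom
    { toFun := fun m =>
        { toFun := fun n => M.res h m ⊗ₜ N.res h n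
          map_zero' := by rw [map_zero, TensorProduct.tmul_zero]
          map_add' := fun _ _ => by rw [map_add, TensorProduct.tmul_add] }
      map_zero' := by ext; simp
      map_add' := fun _ _ => by ext; simp [TensorProduct.add_tmul] }
    (fun r m n => by
      change M.res h (r • m) ⊗ₜ N.res h n = M.res h m ⊗ₜ N.res h (r • n)
      rw [PreMod.res, PreMod.res, M.ares_smul, N.ares_smul, TensorProduct.smul_tmul])

@[simp] lemma tres_tmul (M N : PreMod A) {U V : Opens X} (h : V ≤ U) (m : M.Sec U) (n : N.Sec U) :
    tres M N h (m ⊗ₜ n) = M.res h m ⊗ₜ N.res h n := rfl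

lemma tres_smul (M N : PreMod A) {U V : Opens X} (h : V ≤ U) (a : RSec A U)
    (t : M.Sec U ⊗[RSec A U] N.Sec U) : tres M N h (a • t) = rres A h a • tres M N h t := by
  induction t with
  | zero => simp
  | add x y hx hy => rw [smul_add, map_add, hx, hy, map_add, smul_add]
  | tmul m n =>
    rw [TensorProduct.smul_tmul', tres_tmul, tres_tmul, TensorProduct.smul_tmul', PreMod.res,
      M.ares_smul]

lemma tres_self (M N : PreMod A) {U : Opens X} (h : U ≤ U) (t : M.Sec U ⊗[RSec A U] N.Sec U) :
    tres M N h t = t := by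
  induction t using TensorProduct.induction_on with
  | zero => simp
  | add x y hx hy => rw [map_add, hx, hy]
  | tmul m n => rw [tres_tmul, PreMod.res, PreMod.res, ares_self, ares_self]

lemma tres_tres (M N : PreMod A) {U V W : Opens X} (h : V ≤ U) (k : W ≤ V)
    (t : M.Sec U ⊗[RSec A U] N.Sec U) : tres M N k (tres M N h t) = tres M N (k.trans h) t := by
  induction t using TensorProduct.induction_on with
  | zero => simp
  | add x y hx hy => rw [map_add, map_add, hx, hy, map_add]
  | tmul m n =>
    rw [tres_tmul, tres_tmul, tres_tmul, PreMod.res, PreMod.res, PreMod.res, PreMod.res,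
      ares_ares, ares_ares]

/-- The presheaf `U ↦ M(U) ⊗_{A(U)} N(U)`. -/
noncomputable def tensorPre (M N : PreMod A) : PreMod A :=
  PreMod.ofSections A (fun U => M.Sec U ⊗[RSec A U] N.Sec U) (fun h => tres M N h)
    (tres_self M N) (tres_tres M N) (tres_smul M N)

/-- The tensor product `M ⊗_A N`: the sheaf of modules generated by `U ↦ M(U) ⊗_{A(U)} N(U)`. -/
noncomputable def tensor (M N : PreMod A) : ShMod A := (tensorPre M N).sheafify

/-- The section of `M ⊗_A N` over `U` defined by an element of `M(U) ⊗_{A(U)} N(U)`. -/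
noncomputable def toTensor (M N : PreMod A) {U : Opens X} :
    M.Sec U ⊗[RSec A U] N.Sec U →ₗ[RSec A U] (tensor M N).Sec U :=
  (tensorPre M N).toSheafify

/-- A family of linear maps `f V : N(V) → N'(V)`, `V ≤ U`, that commutes with restrictions, that is,
a morphism `N|_U → N'|_U`, induces the map `1 ⊗ f` from the sections of `M ⊗_A N` over `U` to those
of `M ⊗_A N'`: it sends the class of `t ∈ M(V) ⊗ N(V)`, `V ≤ U`, to the class of `(1 ⊗ f V) t`. -/
noncomputable def oneTensor (M : PreMod A) {N N' : PreMod A} {U : Opens X}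
    (f : ∀ V : Opens X, V ≤ U → N.Sec V →ₗ[RSec A V] N'.Sec V)
    (hf : ∀ (V W : Opens X) (h : V ≤ U) (k : W ≤ V) (x : N.Sec V),
      N'.res k (f V h x) = f W (k.trans h) (N.res k x)) :
    (tensor M N).Sec U → (tensor M N').Sec U :=
  extend (T := (tensorPre M N).ab) (F := (tensor M N').ab) (tensor M N').isSheaf
    (fun V h t => toTensor M N' ((f V h).lTensor (M.Sec V) t))
    (fun V W h k t => by
      refine (ares_toShf (tensorPre M N').ab k _).trans (congrArg (toShf (tensorPre M N').ab) ?_)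
      change tres M N' k ((f V h).lTensor (M.Sec V) t) =
        (f W (k.trans h)).lTensor (M.Sec W) (tres M N k t)
      induction t using TensorProduct.induction_on with
      | zero => simp
      | add x y hx hy => rw [map_add, map_add, hx, hy, map_add, map_add]
      | tmul m n => rw [LinearMap.lTensor_tmul, tres_tmul, tres_tmul, LinearMap.lTensor_tmul, hf])

/-- The presheaf of modules `U ↦ M_n(A(U))`, which is the sheaf `M_n(A)`. -/
def matMod (A : X.Sheaf CommRingCat.{u}) (n : ℕ) : PreMod A :=
  PreMod.ofSections A (fun U => Matrix (Fin n) (Fin n) (RSec A U))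
    (fun h => (rres A h).mapMatrix.toAddMonoidHom)
    (fun h m => by ext i j; exact rres_self A _ _)
    (fun h k m => by ext i j; exact rres_rres A _ _ _)
    (fun h a m => by ext i j; exact map_mul (rres A h) _ _)

/-- A matrix with entries in `A(U)` as a section of `M_n(A)`. -/
def matSec (A : X.Sheaf CommRingCat.{u}) (n : ℕ) (U : Opens X) :
    Matrix (Fin n) (Fin n) (RSec A U) ≃ₗ[RSec A U] (matMod A n).Sec U :=
  LinearEquiv.refl _ _

end Tensor

/-! ### Differential triads and sheaves of groups of Lie type -/

section LieType

/-- A differential triad `(A, d, Ω¹)` over `X`: a sheaf `A` of unital commutative associative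
`K`-algebras, an `A`-module `Ω¹` and a `K`-linear derivation `d : A → Ω¹`. -/
structure Triad (K : Type v) [Field K] (X : TopCat.{u}) where
  A : X.Sheaf CommRingCat.{u}
  [algebra : ∀ U : Opens X, Algebra K (RSec A U)]
  rres_algebraMap : ∀ {U V : Opens X} (h : V ≤ U) (c : K),
    rres A h (algebraMap K (RSec A U) c) = algebraMap K (RSec A V) c
  Ω : ShMod A
  d : ∀ U : Opens X, RSec A U →+ Ω.Sec U
  res_d : ∀ {U V : Opens X} (h : V ≤ U) (a : RSec A U), Ω.res h (d U a) = d V (rres A h a)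
  d_smul : ∀ (U : Opens X) (c : K) (a : RSec A U),
    d U (c • a) = algebraMap K (RSec A U) c • d U a
  d_mul : ∀ (U : Opens X) (s t : RSec A U), d U (s * t) = s • d U t + t • d U s

attribute [instance] Triad.algebra

variable {X : TopCat.{u}}

/-- An `A`-module of Lie algebras. -/
structure LieSheaf (A : X.Sheaf CommRingCat.{u}) extends ShMod A where
  bracket : ∀ U : Opens X, toShMod.Sec U →ₗ[RSec A U] toShMod.Sec U →ₗ[RSec A U] toShMod.Sec U
  bracket_self : ∀ (U : Opens X) (x : toShMod.Sec U), bracket U x x = 0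
  jacobi : ∀ (U : Opens X) (x y z : toShMod.Sec U),
    bracket U x (bracket U y z) = bracket U (bracket U x y) z + bracket U y (bracket U x z)
  res_bracket : ∀ {U V : Opens X} (h : V ≤ U) (x y : toShMod.Sec U),
    toShMod.res h (bracket U x y) = bracket V (toShMod.res h x) (toShMod.res h y)

/-- A representation `ϱ : G → Aut(L)` of a sheaf of groups in an `A`-module of Lie algebras. The
automorphism of `L|_U` attached to `g ∈ G(U)` is the family `ϱ V (g|_V)`, `V ≤ U`. -/
structure LieAction (A : X.Sheaf CommRingCat.{u}) (G : X.Sheaf GrpCat.{u}) (L : LieSheaf A) where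
  hom : ∀ U : Opens X, GSec G U →* (L.Sec U ≃ₗ[RSec A U] L.Sec U)
  hom_bracket : ∀ (U : Opens X) (g : GSec G U) (x y : L.Sec U),
    hom U g (L.bracket U x y) = L.bracket U (hom U g x) (hom U g y)
  res_hom : ∀ {U V : Opens X} (h : V ≤ U) (g : GSec G U) (x : L.Sec U),
    L.res h (hom U g x) = hom V (gres G h g) (L.res h x)

/-- The action `ϱ(g).ω = (1 ⊗ ϱ(g)).ω` of `g ∈ G(U)` on `ω ∈ (M ⊗_A L)(U)`. -/
noncomputable def LieAction.act {A : X.Sheaf CommRingCat.{u}} {G : X.Sheaf GrpCat.{u}}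
    {L : LieSheaf A} (ϱ : LieAction A G L) (M : PreMod A) {U : Opens X} (g : GSec G U)
    (ω : (tensor M L.toPreMod).Sec U) : (tensor M L.toPreMod).Sec U :=
  oneTensor M (fun V h => (ϱ.hom V (gres G h g)).toLinearMap)
    (fun V W h k x => by
      rw [LinearEquiv.coe_coe, LinearEquiv.coe_coe, ← gres_gres G h k]
      exact ϱ.res_hom k _ x) ω

variable {K : Type v} [Field K]

/-- A sheaf of groups of Lie type: a sheaf of groups `G`, a representation `ϱ` of `G` in an
`A`-module of Lie algebras `L`, and a Maurer-Cartan differential `∂ : G → Ω¹ ⊗_A L`. -/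
structure LieTypeGroup (T : Triad K X) where
  G : X.Sheaf GrpCat.{u}
  L : LieSheaf T.A
  ϱ : LieAction T.A G L
  mc : ∀ U : Opens X, GSec G U → (tensor T.Ω.toPreMod L.toPreMod).Sec U
  res_mc : ∀ {U V : Opens X} (h : V ≤ U) (g : GSec G U),
    (tensor T.Ω.toPreMod L.toPreMod).res h (mc U g) = mc V (gres G h g)
  mc_mul : ∀ (U : Opens X) (s t : GSec G U),
    mc U (s * t) = ϱ.act T.Ω.toPreMod t⁻¹ (mc U s) + mc U t

/-- The section `∑ θ_ij ⊗ E_ij` of `Ω¹ ⊗_A M_n(A)` over `U` identified with the matrix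
`(θ_ij)` of sections of `Ω¹` over `U`. -/
noncomputable def Triad.ofMatrix (T : Triad K X) {n : ℕ} {U : Opens X}
    (θ : Matrix (Fin n) (Fin n) (T.Ω.Sec U)) : (tensor T.Ω.toPreMod (matMod T.A n)).Sec U :=
  toTensor T.Ω.toPreMod (matMod T.A n) (∑ i, ∑ j, θ i j ⊗ₜ matSec T.A n U (Matrix.single i j 1))

/-- The Maurer-Cartan differential `a ↦ a⁻¹ · (d a_ij)` of `GL(n, A)`, with values in
`Ω¹ ⊗_A M_n(A)`; the matrix `a⁻¹` acts on the second factor. -/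
noncomputable def Triad.mcGL (T : Triad K X) {n : ℕ} {U : Opens X}
    (a : GL (Fin n) (RSec T.A U)) : (tensor T.Ω.toPreMod (matMod T.A n)).Sec U :=
  toTensor T.Ω.toPreMod (matMod T.A n)
    (∑ i, ∑ j, T.d U (a.1 i j) ⊗ₜ matSec T.A n U ((a⁻¹).1 * Matrix.single i j 1))

/-- A representation `φ : G → GL(n, A)`: a morphism of sheaves of groups. -/
structure Rep (A : X.Sheaf CommRingCat.{u}) (G : X.Sheaf GrpCat.{u}) (n : ℕ) where
  hom : ∀ U : Opens X, GSec G U →* GL (Fin n) (RSec A U)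
  res_hom : ∀ {U V : Opens X} (h : V ≤ U) (g : GSec G U),
    Matrix.GeneralLinearGroup.map (rres A h) (hom U g) = hom V (gres G h g)

/-- A morphism `L → M_n(A)` of sheaves of Lie algebras, where the bracket of `M_n(A)` is the
commutator. -/
structure LieMor {A : X.Sheaf CommRingCat.{u}} (L : LieSheaf A) (n : ℕ) where
  hom : ∀ U : Opens X, L.Sec U →ₗ[RSec A U] Matrix (Fin n) (Fin n) (RSec A U)
  hom_bracket : ∀ (U : Opens X) (x y : L.Sec U),
    hom U (L.bracket U x y) = hom U x * hom U y - hom U y * hom U x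
  res_hom : ∀ {U V : Opens X} (h : V ≤ U) (x : L.Sec U),
    (hom U x).map (rres A h) = hom V (L.res h x)

/-- The morphism `1 ⊗ φ̄ : M ⊗_A L → M ⊗_A M_n(A)`, on sections over `U`. -/
noncomputable def LieMor.oneTensor {A : X.Sheaf CommRingCat.{u}} {L : LieSheaf A} {n : ℕ}
    (f : LieMor L n) (M : PreMod A) {U : Opens X} :
    (tensor M L.toPreMod).Sec U → (tensor M (matMod A n)).Sec U :=
  AssocSheaf.oneTensor M (fun V _ => (matSec A n V).toLinearMap ∘ₗ f.hom V)
    (fun _ _ _ k x => f.res_hom k x)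

/-- `φ : G → GL(n, A)` is of Lie type with respect to `φ̄ : L → M_n(A)`: these are compatible with
the Maurer-Cartan differentials, `∂̃ ∘ φ = (1 ⊗ φ̄) ∘ ∂`, and with the representations,
`φ̄ ∘ ϱ(g) = Ad(φ(g)) ∘ φ̄`. -/
structure IsLieType {T : Triad K X} (𝒢 : LieTypeGroup T) {n : ℕ} (φ : Rep T.A 𝒢.G n)
    (φbar : LieMor 𝒢.L n) : Prop where
  mcGL_hom : ∀ (U : Opens X) (g : GSec 𝒢.G U),
    T.mcGL (φ.hom U g) = φbar.oneTensor T.Ω.toPreMod (𝒢.mc U g)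
  hom_ϱ : ∀ (U : Opens X) (g : GSec 𝒢.G U) (x : 𝒢.L.Sec U),
    φbar.hom U (𝒢.ϱ.hom U g x) = (φ.hom U g).1 * φbar.hom U x * (φ.hom U g)⁻¹.1

end LieType

/-! ### Principal sheaves -/

section Principal

variable {X : TopCat.{u}}

/-- A right action of a sheaf of groups on a sheaf of sets. -/
structure RightAction (P : X.Sheaf (Type u)) (G : X.Sheaf GrpCat.{u}) where
  act : ∀ U : Opens X, SSec P U → GSec G U → SSec P U
  act_one : ∀ (U : Opens X) (s : SSec P U), act U s 1 = s
  act_mul : ∀ (U : Opens X) (s : SSec P U) (g g' : GSec G U),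
    act U s (g * g') = act U (act U s g) g'
  res_act : ∀ {U V : Opens X} (h : V ≤ U) (s : SSec P U) (g : GSec G U),
    sres P h (act U s g) = act V (sres P h s) (gres G h g)

/-- A `G`-equivariant isomorphism `P|_W ≅ G|_W`. -/
structure LocalTriv {P : X.Sheaf (Type u)} {G : X.Sheaf GrpCat.{u}} (r : RightAction P G)
    (W : Opens X) where
  equiv : ∀ V : Opens X, V ≤ W → SSec P V ≃ GSec G V
  res_equiv : ∀ (U V : Opens X) (h : U ≤ W) (k : V ≤ U) (s : SSec P U),
    gres G k (equiv U h s) = equiv V (k.trans h) (sres P k s)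
  equiv_act : ∀ (V : Opens X) (h : V ≤ W) (s : SSec P V) (g : GSec G V),
    equiv V h (r.act V s g) = equiv V h s * g

/-- A principal sheaf with structure sheaf `G`: a sheaf of sets with a right action of `G` that is
locally isomorphic, equivariantly, to `G`. -/
structure PrincipalSheaf (G : X.Sheaf GrpCat.{u}) where
  P : X.Sheaf (Type u)
  action : RightAction P G
  locally_trivial : ∀ x : X, ∃ W : Opens X, x ∈ W ∧ Nonempty (LocalTriv action W)

/-- Sections of a principal sheaf. -/
abbrev PrincipalSheaf.Sec {G : X.Sheaf GrpCat.{u}} (P : PrincipalSheaf G) (U : Opens X) : Type u :=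
  SSec P.P U

/-- Restriction of sections of a principal sheaf. -/
abbrev PrincipalSheaf.res {G : X.Sheaf GrpCat.{u}} (P : PrincipalSheaf G) {U V : Opens X}
    (h : V ≤ U) : P.Sec U → P.Sec V := sres P.P h

/-- The right action `s · g` on sections. -/
abbrev PrincipalSheaf.act {G : X.Sheaf GrpCat.{u}} (P : PrincipalSheaf G) {U : Opens X}
    (s : P.Sec U) (g : GSec G U) : P.Sec U := P.action.act U s g

lemma g_ext {G : X.Sheaf GrpCat.{u}} {U : Opens X} (s t : GSec G U)
    (h : ∀ x ∈ U, ∃ (V : Opens X) (hV : V ≤ U), x ∈ V ∧ gres G hV s = gres G hV t) : s = t :=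
  TopCat.Presheaf.IsSheaf.section_ext G.2 fun x hx => by
    obtain ⟨V, hV, hxV, e⟩ := h x hx
    exact ⟨V, hV, hxV, e⟩

lemma s_ext {P : X.Sheaf (Type u)} {U : Opens X} (s t : SSec P U)
    (h : ∀ x ∈ U, ∃ (V : Opens X) (hV : V ≤ U), x ∈ V ∧ sres P hV s = sres P hV t) : s = t :=
  TopCat.Presheaf.IsSheaf.section_ext P.2 fun x hx => by
    obtain ⟨V, hV, hxV, e⟩ := h x hx
    exact ⟨V, hV, hxV, e⟩

lemma PrincipalSheaf.act_injective {G : X.Sheaf GrpCat.{u}} (P : PrincipalSheaf G) {U : Opens X}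
    (s : P.Sec U) (g g' : GSec G U) (h : P.act s g = P.act s g') : g = g' := by
  refine g_ext g g' fun x hx => ?_
  obtain ⟨W, hxW, ⟨ψ⟩⟩ := P.locally_trivial x
  refine ⟨U ⊓ W, inf_le_left, ⟨hx, hxW⟩, ?_⟩
  have e := congrArg (fun t => ψ.equiv _ inf_le_right (P.res (inf_le_left : U ⊓ W ≤ U) t)) h
  simpa only [P.action.res_act, PrincipalSheaf.res, PrincipalSheaf.act, ψ.equiv_act,
    mul_right_inj] using e

lemma PrincipalSheaf.exists_act_eq {G : X.Sheaf GrpCat.{u}} (P : PrincipalSheaf G) {U : Opens X}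
    (s t : P.Sec U) : ∃ g : GSec G U, t = P.act s g := by
  have key : ∀ x : U, ∃ (V : Opens X) (h : V ≤ U) (g : GSec G V), x.1 ∈ V ∧
      P.res h t = P.act (P.res h s) g := fun x => by
    obtain ⟨W, hxW, ⟨ψ⟩⟩ := P.locally_trivial x.1
    refine ⟨U ⊓ W, inf_le_left, (ψ.equiv _ inf_le_right (P.res inf_le_left s))⁻¹ *
      ψ.equiv _ inf_le_right (P.res inf_le_left t), ⟨x.2, hxW⟩, ?_⟩
    apply (ψ.equiv _ inf_le_right).injective
    rw [ψ.equiv_act, mul_inv_cancel_left]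
  choose V hV g hx hg using key
  obtain ⟨γ, hγ, -⟩ := TopCat.Sheaf.existsUnique_gluing' G V U (fun i => homOfLE (hV i))
    (fun x hxU => Opens.mem_iSup.2 ⟨⟨x, hxU⟩, hx _⟩) g (fun i j => by
      change gres G inf_le_left (g i) = gres G inf_le_right (g j)
      apply P.act_injective (P.res ((inf_le_left : V i ⊓ V j ≤ V i).trans (hV i)) s)
      have hi := congrArg (P.res (inf_le_left : V i ⊓ V j ≤ V i)) (hg i)
      have hj := congrArg (P.res (inf_le_right : V i ⊓ V j ≤ V j)) (hg j)
      simp only [PrincipalSheaf.res, PrincipalSheaf.act, P.action.res_act, sres_sres] at hi hj ⊢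
      exact hi.symm.trans hj)
  refine ⟨γ, s_ext _ _ fun x hxU => ⟨V ⟨x, hxU⟩, hV _, hx _, ?_⟩⟩
  have := hγ ⟨x, hxU⟩
  change gres G (hV _) γ = _ at this
  rw [P.action.res_act, this]
  exact hg _

end Principal

/-! ### The associated sheaf -/

section Associated

variable {X : TopCat.{u}} {A : X.Sheaf CommRingCat.{u}} {G : X.Sheaf GrpCat.{u}} {n : ℕ}

/-- `φ(g) · a` for `g ∈ G(U)` and `a ∈ Aⁿ(U)`. -/
def Rep.mulVec (φ : Rep A G n) {U : Opens X} (g : GSec G U) (a : Fin n → RSec A U) :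
    Fin n → RSec A U :=
  Matrix.mulVec (φ.hom U g).1 a

lemma Rep.one_mulVec (φ : Rep A G n) {U : Opens X} (a : Fin n → RSec A U) :
    φ.mulVec 1 a = a := by
  rw [Rep.mulVec, map_one]
  exact Matrix.one_mulVec a

lemma Rep.mul_mulVec (φ : Rep A G n) {U : Opens X} (g g' : GSec G U) (a : Fin n → RSec A U) :
    φ.mulVec (g * g') a = φ.mulVec g (φ.mulVec g' a) := by
  rw [Rep.mulVec, map_mul]
  exact (Matrix.mulVec_mulVec a _ _).symm

lemma Rep.mulVec_add (φ : Rep A G n) {U : Opens X} (g : GSec G U) (a b : Fin n → RSec A U) :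
    φ.mulVec g (a + b) = φ.mulVec g a + φ.mulVec g b := Matrix.mulVec_add _ _ _

lemma Rep.mulVec_smul (φ : Rep A G n) {U : Opens X} (g : GSec G U) (c : RSec A U)
    (a : Fin n → RSec A U) : φ.mulVec g (c • a) = c • φ.mulVec g a := Matrix.mulVec_smul _ _ _

lemma Rep.res_mulVec (φ : Rep A G n) {U V : Opens X} (h : V ≤ U) (g : GSec G U)
    (a : Fin n → RSec A U) :
    rres A h ∘ φ.mulVec g a = φ.mulVec (gres G h g) (rres A h ∘ a) := by
  rw [Rep.mulVec, Rep.mulVec, ← φ.res_hom h g]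
  exact funext fun i => RingHom.map_mulVec (rres A h) _ _ i

variable (P : PrincipalSheaf G) (φ : Rep A G n)

/-- The equivalence relation on `P(U) × Aⁿ(U)`: `(s, a) ∼ (t, b)` if and only if there is a unique
`g ∈ G(U)` with `t = s · g` and `b = φ(g⁻¹) · a`. -/
def assocSetoid (U : Opens X) : Setoid (P.Sec U × (Fin n → RSec A U)) where
  r p q := ∃! g : GSec G U, q.1 = P.act p.1 g ∧ q.2 = φ.mulVec g⁻¹ p.2
  iseqv :=
    { refl := fun p => ⟨1, ⟨(P.action.act_one _ _).symm, by rw [inv_one, φ.one_mulVec]⟩,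
        fun g hg => P.act_injective p.1 _ _ (hg.1.symm.trans (P.action.act_one _ _).symm)⟩
      symm := by
        rintro p q ⟨g, ⟨h₁, h₂⟩, -⟩
        have e : p.1 = P.act q.1 g⁻¹ := by
          rw [h₁, PrincipalSheaf.act, PrincipalSheaf.act, ← P.action.act_mul, mul_inv_cancel,
            P.action.act_one]
        refine ⟨g⁻¹, ⟨e, ?_⟩, fun k hk => P.act_injective q.1 _ _ (hk.1.symm.trans e)⟩
        rw [h₂, ← φ.mul_mulVec, inv_inv, mul_inv_cancel, φ.one_mulVec]
      trans := by
        rintro p q r ⟨g, ⟨h₁, h₂⟩, -⟩ ⟨k, ⟨k₁, k₂⟩, -⟩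
        have e : r.1 = P.act p.1 (g * k) := by
          rw [k₁, h₁, PrincipalSheaf.act, PrincipalSheaf.act, PrincipalSheaf.act, P.action.act_mul]
        refine ⟨g * k, ⟨e, ?_⟩, fun l hl => P.act_injective p.1 _ _ (hl.1.symm.trans e)⟩
        rw [k₂, h₂, ← φ.mul_mulVec, mul_inv_rev] }

/-- The quotient set `Q(U) = (P(U) × Aⁿ(U)) / G(U)`. -/
abbrev Q (U : Opens X) : Type u := Quotient (assocSetoid P φ U)

/-- Restriction of classes, `[s, a] ↦ [s|_V, a|_V]`. -/
def qres {U V : Opens X} (h : V ≤ U) : Q P φ U → Q P φ V :=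
  Quotient.map (fun p => (P.res h p.1, rres A h ∘ p.2)) (by
    rintro p q ⟨g, ⟨h₁, h₂⟩, -⟩
    have e : P.res h q.1 = P.act (P.res h p.1) (gres G h g) := by
      rw [h₁, PrincipalSheaf.res, P.action.res_act]
    refine ⟨gres G h g, ⟨e, ?_⟩, fun k hk => P.act_injective _ _ _ (hk.1.symm.trans e)⟩
    change rres A h ∘ q.2 = φ.mulVec (gres G h g)⁻¹ (rres A h ∘ p.2)
    rw [h₂, φ.res_mulVec, map_inv])

/-- The presheaf of sets `U ↦ Q(U)`. -/
def qPre : X.Presheaf (Type u) where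
  obj U := Q P φ U.unop
  map f := TypeCat.ofHom (qres P φ (leOfHom f.unop))
  map_id U := by
    ext q
    induction q using Quotient.ind with | _ p => ?_
    change Quotient.mk (assocSetoid P φ U.unop) _ = Quotient.mk (assocSetoid P φ U.unop) _
    congr 1
    exact Prod.ext (sres_self _ _ _) (funext fun i => rres_self A _ _)
  map_comp {U V W} f g := by
    ext q
    induction q using Quotient.ind with | _ p => ?_
    change Quotient.mk (assocSetoid P φ W.unop) _ = Quotient.mk (assocSetoid P φ W.unop) _
    congr 1
    exact Prod.ext (sres_sres _ _ _ _).symm (funext fun i => (rres_rres A _ _ _).symm)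

/-- The sheaf of sets `E` generated by the presheaf `U ↦ Q(U)`. -/
noncomputable def assocSet : X.Sheaf (Type u) :=
  (presheafToSheaf (Opens.grothendieckTopology X) (Type u)).obj (qPre P φ)

/-- The section `[s, a]` of `E` over `U` defined by `s ∈ P(U)` and `a ∈ Aⁿ(U)`. -/
noncomputable def cls {U : Opens X} (s : P.Sec U) (a : Fin n → RSec A U) :
    SSec (assocSet P φ) U :=
  (toSheafify (Opens.grothendieckTopology X) (qPre P φ)).app (op U)
    (Quotient.mk (assocSetoid P φ U) (s, a))

lemma sres_cls {U V : Opens X} (h : V ≤ U) (s : P.Sec U) (a : Fin n → RSec A U) :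
    sres (assocSet P φ) h (cls P φ s a) = cls P φ (P.res h s) (rres A h ∘ a) := by
  have := (toSheafify (Opens.grothendieckTopology X) (qPre P φ)).naturality (homOfLE h).op
  exact (ConcreteCategory.congr_hom this (Quotient.mk (assocSetoid P φ U) (s, a))).symm

lemma cls_act {U : Opens X} (s : P.Sec U) (g : GSec G U) (a : Fin n → RSec A U) :
    cls P φ (P.act s g) a = cls P φ s (φ.mulVec g a) := by
  refine congrArg _ (Quotient.sound ((assocSetoid P φ U).iseqv.symm ?_))
  refine ⟨g, ⟨rfl, ?_⟩, fun k hk => P.act_injective _ _ _ hk.1.symm⟩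
  rw [← φ.mul_mulVec, inv_mul_cancel, φ.one_mulVec]

lemma cls_injective {U : Opens X} (s : P.Sec U) : Function.Injective (cls P φ s) := by
  intro a b hab
  refine funext fun i => TopCat.Presheaf.IsSheaf.section_ext A.2 fun x hx => ?_
  obtain ⟨V, f, hf, hV⟩ := Presheaf.equalizerSieve_mem (Opens.grothendieckTopology X)
    (toSheafify (Opens.grothendieckTopology X) (qPre P φ)) _ _ hab x hx
  refine ⟨V, leOfHom f, hV, ?_⟩
  obtain ⟨g, ⟨h₁, h₂⟩, -⟩ := (Quotient.eq (r := assocSetoid P φ V)).1 hf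
  have hg : g = 1 := P.act_injective _ _ _ (h₁.symm.trans (P.action.act_one _ _).symm)
  rw [hg, inv_one, φ.one_mulVec] at h₂
  exact (congrFun h₂ i).symm

lemma cls_locally_surj {U : Opens X} (y : SSec (assocSet P φ) U) (x : X) (hx : x ∈ U) :
    ∃ (V : Opens X) (h : V ≤ U) (s : P.Sec V) (a : Fin n → RSec A V), x ∈ V ∧
      cls P φ s a = sres (assocSet P φ) h y := by
  obtain ⟨V, f, ⟨q, hq⟩, hV⟩ := Presheaf.imageSieve_mem (Opens.grothendieckTopology X)
    (toSheafify (Opens.grothendieckTopology X) (qPre P φ)) y x hx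
  obtain ⟨⟨s, a⟩, rfl⟩ := Quotient.exists_rep q
  exact ⟨V, leOfHom f, s, a, hV, hq⟩

lemma cls_surjective {U : Opens X} (s : P.Sec U) : Function.Surjective (cls P φ s) := by
  intro y
  have key : ∀ x : U, ∃ (V : Opens X) (h : V ≤ U) (a : Fin n → RSec A V), x.1 ∈ V ∧
      cls P φ (P.res h s) a = sres (assocSet P φ) h y := fun x => by
    obtain ⟨V, h, t, a, hV, e⟩ := cls_locally_surj P φ y x.1 x.2
    obtain ⟨g, rfl⟩ := P.exists_act_eq (P.res h s) t
    exact ⟨V, h, φ.mulVec g a, hV, by rw [← cls_act, e]⟩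
  choose V hV a hx ha using key
  have glue : ∀ i : Fin n, ∃ b : RSec A U, ∀ x, rres A (hV x) b = a x i := fun i => by
    obtain ⟨b, hb, -⟩ := TopCat.Sheaf.existsUnique_gluing' A V U (fun x => homOfLE (hV x))
      (fun x hxU => Opens.mem_iSup.2 ⟨⟨x, hxU⟩, hx _⟩) (fun x => a x i) (fun x y => by
        change rres A inf_le_left (a x i) = rres A inf_le_right (a y i)
        refine congrFun (f := rres A inf_le_left ∘ a x) (g := rres A inf_le_right ∘ a y) ?_ i
        apply cls_injective P φ (P.res (inf_le_left.trans (hV x)) s)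
        have e₁ := congrArg (sres (assocSet P φ) (inf_le_left : V x ⊓ V y ≤ V x)) (ha x)
        have e₂ := congrArg (sres (assocSet P φ) (inf_le_right : V x ⊓ V y ≤ V y)) (ha y)
        rw [sres_cls, sres_sres, PrincipalSheaf.res, PrincipalSheaf.res, sres_sres] at e₁ e₂
        exact e₁.trans e₂.symm)
    exact ⟨b, hb⟩
  choose b hb using glue
  refine ⟨b, s_ext _ _ fun x hxU => ⟨V ⟨x, hxU⟩, hV _, hx _, ?_⟩⟩
  rw [sres_cls, ← ha]
  exact congrArg _ (funext fun i => hb i _)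

/-- The bijection `ψ_s : Aⁿ(U) → E(U)`, `a ↦ [s, a]`, attached to a section `s ∈ P(U)`. -/
noncomputable def frame {U : Opens X} (s : P.Sec U) :
    (Fin n → RSec A U) ≃ SSec (assocSet P φ) U :=
  Equiv.ofBijective (cls P φ s) ⟨cls_injective P φ s, cls_surjective P φ s⟩

lemma frame_apply {U : Opens X} (s : P.Sec U) (a : Fin n → RSec A U) :
    frame P φ s a = cls P φ s a := rfl

lemma frame_symm_res {U V W : Opens X} (h : V ≤ U) (k : W ≤ V) (s : P.Sec V)
    (y : SSec (assocSet P φ) U) :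
    rres A k ∘ (frame P φ s).symm (sres _ h y) =
      (frame P φ (P.res k s)).symm (sres _ (k.trans h) y) := by
  rw [Equiv.eq_symm_apply, frame_apply, ← sres_cls, ← frame_apply, Equiv.apply_symm_apply,
    sres_sres]

lemma frame_symm_act {U : Opens X} (s : P.Sec U) (g : GSec G U) (y : SSec (assocSet P φ) U) :
    (frame P φ (P.act s g)).symm y = φ.mulVec g⁻¹ ((frame P φ s).symm y) := by
  rw [Equiv.symm_apply_eq, frame_apply, cls_act, ← φ.mul_mulVec, mul_inv_cancel, φ.one_mulVec,
    ← frame_apply, Equiv.apply_symm_apply]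

/-- A section of `E` over `U` is determined by its coordinates in the frames `ψ_s`, `s ∈ P(V)`,
`V ≤ U`. -/
lemma assoc_ext {U : Opens X} (y z : SSec (assocSet P φ) U)
    (h : ∀ (V : Opens X) (h : V ≤ U) (s : P.Sec V), (frame P φ s).symm (sres _ h y) =
      (frame P φ s).symm (sres _ h z)) : y = z :=
  s_ext _ _ fun x hx => by
    obtain ⟨V, hV, s, a, hxV, e⟩ := cls_locally_surj P φ y x hx
    exact ⟨V, hV, hxV, (frame P φ s).symm.injective (h V hV s)⟩

/-- A family of coordinates that is compatible with restriction and with change of frame comes from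
a unique section of `E`. -/
lemma assoc_glue {U : Opens X} (c : ∀ V : Opens X, V ≤ U → P.Sec V → Fin n → RSec A V)
    (hc : ∀ (V W : Opens X) (h : V ≤ U) (k : W ≤ V) (s : P.Sec V),
      rres A k ∘ c V h s = c W (k.trans h) (P.res k s))
    (hg : ∀ (V : Opens X) (h : V ≤ U) (s : P.Sec V) (g : GSec G V),
      c V h (P.act s g) = φ.mulVec g⁻¹ (c V h s)) :
    ∃! y : SSec (assocSet P φ) U, ∀ (V : Opens X) (h : V ≤ U) (s : P.Sec V),
      (frame P φ s).symm (sres _ h y) = c V h s := by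
  let ι := {i : Σ V : Opens X, P.Sec V // i.1 ≤ U}
  obtain ⟨y, hy, -⟩ := TopCat.Sheaf.existsUnique_gluing' (assocSet P φ) (fun i : ι => i.1.1) U
    (fun i => homOfLE i.2)
    (fun x hx => by
      obtain ⟨W, hxW, ⟨ψ⟩⟩ := P.locally_trivial x
      exact Opens.mem_iSup.2 ⟨⟨⟨U ⊓ W, (ψ.equiv _ inf_le_right).symm 1⟩, inf_le_left⟩, hx, hxW⟩)
    (fun i => cls P φ i.1.2 (c _ i.2 i.1.2))
    (by
      rintro ⟨⟨V, s⟩, h⟩ ⟨⟨V', s'⟩, h'⟩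
      change sres (assocSet P φ) inf_le_left (cls P φ s (c V h s)) =
        sres (assocSet P φ) inf_le_right (cls P φ s' (c V' h' s'))
      rw [sres_cls, sres_cls, hc, hc]
      obtain ⟨g, hg'⟩ := P.exists_act_eq (P.res (inf_le_left : V ⊓ V' ≤ V) s)
        (P.res (inf_le_right : V ⊓ V' ≤ V') s')
      rw [hg', cls_act, hg, ← φ.mul_mulVec, mul_inv_cancel, φ.one_mulVec])
  have hy' : ∀ (V : Opens X) (h : V ≤ U) (s : P.Sec V),
      (frame P φ s).symm (sres _ h y) = c V h s := fun V h s => by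
    rw [Equiv.symm_apply_eq]
    exact hy ⟨⟨V, s⟩, h⟩
  exact ⟨y, hy', fun z hz => assoc_ext P φ _ _ fun V h s => by rw [hz, hy']⟩

/-- The module of families of coordinates of sections of `E` over `U`. -/
abbrev coordFamilies (U : Opens X) :=
  letI : ∀ V : {V : Opens X // V ≤ U}, Module (RSec A U) (RSec A V.1) :=
    fun V => Module.compHom _ (rres A V.2)
  ({ carrier := {c | (∀ (V W : {V : Opens X // V ≤ U}) (k : W.1 ≤ V.1) (s : P.Sec V.1),
        rres A k ∘ c V s = c W (P.res k s)) ∧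
        ∀ (V : {V : Opens X // V ≤ U}) (s : P.Sec V.1) (g : GSec G V.1),
          c V (P.act s g) = φ.mulVec g⁻¹ (c V s)}
     add_mem' := fun {c c'} hc hc' => ⟨fun V W k s => by
        rw [Pi.add_apply, Pi.add_apply, Pi.add_apply, Pi.add_apply, ← hc.1 V W k s, ← hc'.1 V W k s]
        exact funext fun i => map_add _ _ _, fun V s g => by
        rw [Pi.add_apply, Pi.add_apply, Pi.add_apply, hc.2, hc'.2, φ.mulVec_add]⟩
     zero_mem' := ⟨fun V W k s => funext fun i => map_zero (rres A k), fun V s g =>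
        (Matrix.mulVec_zero _).symm⟩
     smul_mem' := fun a c hc => ⟨fun V W k s => by
        rw [Pi.smul_apply, Pi.smul_apply, Pi.smul_apply, Pi.smul_apply, ← hc.1 V W k s]
        refine funext fun i => (map_mul (rres A k) (rres A V.2 a) (c V s i)).trans ?_
        rw [rres_rres]
        rfl, fun V s g => by
        rw [Pi.smul_apply, Pi.smul_apply, Pi.smul_apply, hc.2]
        exact (φ.mulVec_smul g⁻¹ (rres A V.2 a) (c V s)).symm⟩ } :
    Submodule (RSec A U) (∀ V : {V : Opens X // V ≤ U}, P.Sec V.1 → Fin n → RSec A V.1))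

/-- A section of `E` corresponds to the family of its coordinates in all frames `ψ_s`. -/
noncomputable def coordEquiv (U : Opens X) : SSec (assocSet P φ) U ≃ coordFamilies P φ U :=
  Equiv.ofBijective
    (fun y => ⟨fun V s => (frame P φ s).symm (sres _ V.2 y),
      fun V _ k s => frame_symm_res P φ V.2 k s y, fun _ s g => frame_symm_act P φ s g _⟩)
    ⟨fun y z h => assoc_ext P φ y z fun V hV s =>
      congrFun (congrFun (congrArg Subtype.val h) ⟨V, hV⟩) s, fun c => by
      obtain ⟨y, hy, -⟩ := assoc_glue P φ (fun V h s => c.1 ⟨V, h⟩ s)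
        (fun V W h k s => c.2.1 ⟨V, h⟩ ⟨W, k.trans h⟩ k s) (fun V h s g => c.2.2 ⟨V, h⟩ s g)
      exact ⟨y, Subtype.ext (funext fun V => funext fun s => hy V.1 V.2 s)⟩⟩

/-- The operations of `E`, defined by the requirement that each `ψ_s` be linear. -/
noncomputable instance (U : Opens X) : AddCommGroup (SSec (assocSet P φ) U) :=
  (coordEquiv P φ U).addCommGroup

/-- The operations of `E`, defined by the requirement that each `ψ_s` be linear. -/
noncomputable instance (U : Opens X) : Module (RSec A U) (SSec (assocSet P φ) U) :=
  (coordEquiv P φ U).module (RSec A U)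

lemma frame_symm_add {U V : Opens X} (h : V ≤ U) (s : P.Sec V) (y z : SSec (assocSet P φ) U) :
    (frame P φ s).symm (sres _ h (y + z)) =
      (frame P φ s).symm (sres _ h y) + (frame P φ s).symm (sres _ h z) :=
  congrFun (congrFun (congrArg Subtype.val
    ((coordEquiv P φ U).apply_symm_apply (coordEquiv P φ U y + coordEquiv P φ U z))) ⟨V, h⟩) s

lemma frame_symm_smul {U V : Opens X} (h : V ≤ U) (s : P.Sec V) (a : RSec A U)
    (y : SSec (assocSet P φ) U) :
    (frame P φ s).symm (sres _ h (a • y)) = rres A h a • (frame P φ s).symm (sres _ h y) :=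
  congrFun (congrFun (congrArg Subtype.val
    ((coordEquiv P φ U).apply_symm_apply (a • coordEquiv P φ U y))) ⟨V, h⟩) s

/-- `ψ_s : Aⁿ(U) → E(U)`, `a ↦ [s, a]`, is an isomorphism of `A(U)`-modules. -/
noncomputable def frameₗ {U : Opens X} (s : P.Sec U) :
    (Fin n → RSec A U) ≃ₗ[RSec A U] SSec (assocSet P φ) U :=
  LinearEquiv.symm
    { (frame P φ s).symm with
      map_add' := fun y z => by
        have := frame_symm_add P φ le_rfl s y z
        rwa [sres_self, sres_self, sres_self] at this
      map_smul' := fun a y => by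
        have := frame_symm_smul P φ le_rfl s a y
        rwa [sres_self, sres_self, rres_self] at this }

lemma frameₗ_apply {U : Opens X} (s : P.Sec U) (a : Fin n → RSec A U) :
    frameₗ P φ s a = cls P φ s a := rfl

/-- Restriction of sections of `E`. -/
noncomputable def assocRes {U V : Opens X} (h : V ≤ U) :
    SSec (assocSet P φ) U →+ SSec (assocSet P φ) V where
  toFun := sres _ h
  map_zero' := by
    refine assoc_ext P φ _ _ fun W k s => ?_
    have h₁ := frame_symm_smul P φ (k.trans h) s 0 0
    have h₂ := frame_symm_smul P φ k s 0 0
    rw [map_zero, zero_smul, zero_smul] at h₁ h₂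
    rw [sres_sres, h₁, h₂]
  map_add' y z := by
    refine assoc_ext P φ _ _ fun W k s => ?_
    rw [sres_sres, frame_symm_add, frame_symm_add, sres_sres, sres_sres]

/-- The vector sheaf `E` associated with `P` by `φ`: the sheaf of sets `E` with the operations for
which each `ψ_s : Aⁿ|_V → E|_V`, `s ∈ P(V)`, is linear. -/
noncomputable def assoc : ShMod A where
  toPreMod := PreMod.ofSections A (SSec (assocSet P φ)) (assocRes P φ) (sres_self _) (sres_sres _)
    (fun h a y => assoc_ext P φ _ _ fun W k s => by
      change _ = (frame P φ s).symm (sres _ k (rres A h a • sres _ h y))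
      rw [frame_symm_smul]
      change (frame P φ s).symm (sres _ k (sres _ h (a • y))) = _
      rw [sres_sres, sres_sres, frame_symm_smul, rres_rres])
  isSheaf := by
    refine (Presheaf.isSheaf_iff_isSheaf_forget _ _ (forget AddCommGrpCat.{u})).2 ?_
    exact (assocSet P φ).2

/-- The section `[s, a]` of the vector sheaf `E` over `U`; it is linear in `a`. -/
noncomputable def assocMk {U : Opens X} (s : P.Sec U) :
    (Fin n → RSec A U) ≃ₗ[RSec A U] (assoc P φ).Sec U :=
  frameₗ P φ s

end Associated

/-! ### Connections -/

section Connections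

variable {X : TopCat.{u}} {K : Type v} [Field K] {T : Triad K X}

/-- A connection on a principal sheaf: a morphism of sheaves of sets `D : P → Ω¹ ⊗_A L` with
`D(s · g) = ϱ(g⁻¹).D(s) + ∂(g)`. -/
@[ext]
structure PrincipalConnection {𝒢 : LieTypeGroup T} (P : PrincipalSheaf 𝒢.G) where
  D : ∀ U : Opens X, P.Sec U → (tensor T.Ω.toPreMod 𝒢.L.toPreMod).Sec U
  res_D : ∀ {U V : Opens X} (h : V ≤ U) (s : P.Sec U),
    (tensor T.Ω.toPreMod 𝒢.L.toPreMod).res h (D U s) = D V (P.res h s)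
  D_act : ∀ (U : Opens X) (s : P.Sec U) (g : GSec 𝒢.G U),
    D U (P.act s g) = 𝒢.ϱ.act T.Ω.toPreMod g⁻¹ (D U s) + 𝒢.mc U g

/-- An `A`-connection on an `A`-module `E`: a `K`-linear morphism of sheaves `∇ : E → E ⊗_A Ω¹`
with `∇(a s) = a ∇(s) + s ⊗ d(a)`. -/
@[ext]
structure LinearConnection (T : Triad K X) (E : ShMod T.A) where
  nabla : ∀ U : Opens X, E.Sec U →+ (tensor E.toPreMod T.Ω.toPreMod).Sec U
  res_nabla : ∀ {U V : Opens X} (h : V ≤ U) (s : E.Sec U),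
    (tensor E.toPreMod T.Ω.toPreMod).res h (nabla U s) = nabla V (E.res h s)
  nabla_const : ∀ (U : Opens X) (c : K) (s : E.Sec U),
    nabla U (algebraMap K (RSec T.A U) c • s) = algebraMap K (RSec T.A U) c • nabla U s
  leibniz : ∀ (U : Opens X) (a : RSec T.A U) (s : E.Sec U),
    nabla U (a • s) = a • nabla U s + toTensor E.toPreMod T.Ω.toPreMod (s ⊗ₜ T.d U a)

/-- `(θ_ij)` is the matrix of local connection forms of `∇` in the basis `e_1, …, e_n` of `E` over
`U`: `∇(e_j) = ∑_i e_i ⊗ θ_ij`. -/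
def LinearConnection.IsMatrix {E : ShMod T.A} (nb : LinearConnection T E) {n : ℕ} {U : Opens X}
    (e : Fin n → E.Sec U) (θ : Matrix (Fin n) (Fin n) (T.Ω.Sec U)) : Prop :=
  ∀ j, nb.nabla U (e j) = ∑ i, toTensor E.toPreMod T.Ω.toPreMod (e i ⊗ₜ θ i j)

/-- The basis `e_j = [s, (0, …, 1, …, 0)]` of the associated sheaf over `U` attached to a section
`s ∈ P(U)`. -/
noncomputable def assocBasis {A : X.Sheaf CommRingCat.{u}} {G : X.Sheaf GrpCat.{u}} {n : ℕ}
    (P : PrincipalSheaf G) (φ : Rep A G n) {U : Opens X} (s : P.Sec U) (j : Fin n) :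
    (assoc P φ).Sec U :=
  assocMk P φ s (Pi.single j 1)

/-- `∇` is induced by `D`: for every section `s` of `P`, over any open set, the matrix `θ` of local
connection forms of `∇` in the basis attached to `s`, viewed as a section of `Ω¹ ⊗_A M_n(A)`, is
`(1 ⊗ φ̄)(D(s))`. -/
def Induces {𝒢 : LieTypeGroup T} {P : PrincipalSheaf 𝒢.G} {n : ℕ} (φ : Rep T.A 𝒢.G n)
    (φbar : LieMor 𝒢.L n) (D : PrincipalConnection P) (nb : LinearConnection T (assoc P φ)) :
    Prop :=
  ∀ (U : Opens X) (s : P.Sec U), ∃ θ : Matrix (Fin n) (Fin n) (T.Ω.Sec U),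
    nb.IsMatrix (assocBasis P φ s) θ ∧
      T.ofMatrix θ = φbar.oneTensor T.Ω.toPreMod (D.D U s)

end Connections

end AssocSheaf

/-! Both kinds of connection are encoded by the same data, `ConnectionMatrices`: a matrix `θ_s` of
sections of `Ω¹` for every local section `s` of `P`, natural under restriction, subject to the gauge
law `θ_{s·g} = φ(g)⁻¹ (θ_s φ(g) + dφ(g))`. The required bijection is the composite of
`principalEquiv` and `linearEquiv`.

On the principal side, `1 ⊗ φ̄` is an isomorphism because `φ̄` is, and `Ω¹ ⊗ M_n(A)` is `M_n(Ω¹)`;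
together they give `matrixEquiv`. The two Lie type conditions say that this identification turns
`ϱ(g⁻¹)` into conjugation by `φ(g)⁻¹` and `∂(g)` into `φ(g)⁻¹ dφ(g)`. The transformation law of `D`
thus becomes exactly the gauge law (`matrixEquiv_act_add_mc`).

On the linear side, a section `s` over `U` trivialises `E` over `U`, so every section of `E ⊗ Ω¹`
over `U` is uniquely `∑ e_i ⊗ ω_i` (`frameForm_bijective`). By the Leibniz rule `∇` is then `a ↦ da
+ θ_s a` in coordinates (`LinearConnection.nabla_eq`). The gauge law expresses that this formula
does not depend on the frame (`covariant_mulVec`). Hence a linear connection yields connection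
matrices, and conversely the local formulas defined by connection matrices glue to a linear
connection.

Uniqueness holds because the prescribed form determines the matrix (`ofMatrix_bijective`), while `P`
has enough local sections for the matrices to determine `∇` (`LinearConnection.ext_of_isMatrix`).

All tensor products here are sheafified. Where one factor is free, `toShf_bijective` shows that
sheafifying changes no sections; in general, identities are checked on local representatives. -/

namespace AssocSheaf

/-! ### Tensor products with a free factor -/

section Frames

variable {X : TopCat.{u}} {A : X.Sheaf CommRingCat.{u}}

/-- If a presheaf `S` is isomorphic over `U` to a power of a sheaf `F`, then it has the same sections
over `U` as the sheaf it generates. -/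
lemma toShf_bijective {S F : X.Presheaf AddCommGrpCat.{u}} (hF : F.IsSheaf) {U : Opens X}
    {ι : Type*} (m : ι → ∀ V : Opens X, V ≤ U → S.obj (op V) → F.obj (op V))
    (hm : ∀ (i : ι) (V W : Opens X) (h : V ≤ U) (k : W ≤ V) (t : S.obj (op V)),
      ares F k (m i V h t) = m i W (k.trans h) (ares S k t))
    (hb : ∀ (V : Opens X) (h : V ≤ U), Function.Bijective fun t i => m i V h t) :
    Function.Bijective (toShf S (U := U)) := by
  constructor
  · intro s t hst
    -- The coordinates lie in the sheaf `F`, so they may be compared locally, where `s` and `t`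
    -- already agree.
    refine (hb U le_rfl).1 (funext fun i => ab_ext hF _ _ fun x hx => ?_)
    obtain ⟨V, hV, hxV, e⟩ := toShf_locally_inj S s t hst x hx
    exact ⟨V, hV, hxV, by rw [hm, hm, e]⟩
  · intro y
    -- The coordinate maps extend to the generated sheaf because `F` is a sheaf. The preimage of `y`
    -- is the section of `S` having the extended coordinates of `y`.
    obtain ⟨t, ht⟩ := (hb U le_rfl).2 fun i => extend hF (m i) (hm i) y
    refine ⟨t, ext_of_shf (shf S).2 y _ _ fun V h t' ht' => ?_⟩
    rw [ares_toShf, ← ht']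
    refine congrArg (toShf S) ((hb V h).1 (funext fun i => ?_))
    calc m i V h (ares S h t) = ares F h (m i U le_rfl t) := (hm i U V le_rfl h t).symm
      _ = ares F h (extend hF (m i) (hm i) y) := congrArg _ (congrFun ht i)
      _ = m i V h t' := extend_spec hF (m i) (hm i) y V h t' ht'

/-- A family of sections over `U` whose restriction to every smaller open set is a basis. -/
structure LocalBasis (M : PreMod A) (U : Opens X) (ι : Type*) where
  basis : ∀ V : Opens X, V ≤ U → Module.Basis ι (RSec A V) (M.Sec V)
  res_basis : ∀ (V W : Opens X) (h : V ≤ U) (k : W ≤ V) (i : ι),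
    M.res k (basis V h i) = basis W (k.trans h) i

namespace LocalBasis

variable {M : PreMod A} {U : Opens X} {ι : Type*} [Fintype ι]

/-- Restricting the expansion of `x` gives an expansion in the restricted basis, and coefficients
are unique. This makes the coordinate maps natural, as `toShf_bijective` requires. -/
lemma rres_repr (b : LocalBasis M U ι) (V W : Opens X) (h : V ≤ U) (k : W ≤ V)
    (x : M.Sec V) (i : ι) :
    rres A k ((b.basis V h).repr x i) = (b.basis W (k.trans h)).repr (M.res k x) i := by
  conv_rhs => rw [← (b.basis V h).sum_repr x, map_sum]
  simp only [PreMod.res, M.ares_smul]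
  simp only [b.res_basis V W h k]
  rw [Module.Basis.repr_sum_self]

/-- The tensor product of a sheaf of modules with a free sheaf of modules, on sections. -/
lemma toTensor_left_bijective [DecidableEq ι] (b : LocalBasis M U ι) (N : ShMod A) :
    Function.Bijective (toTensor M N.toPreMod (U := U)) := by
  refine toShf_bijective (S := (tensorPre M N.toPreMod).ab) N.isSheaf (ι := ι)
    (fun i V h t => TensorProduct.equivFinsuppOfBasisLeft (b.basis V h) t i) ?_ fun V h =>
      (Finsupp.equivFunOnFinite.bijective.comp
        (TensorProduct.equivFinsuppOfBasisLeft (b.basis V h)).bijective)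
  intro i V W h k t
  change N.res k (TensorProduct.equivFinsuppOfBasisLeft (b.basis V h) t i) =
    TensorProduct.equivFinsuppOfBasisLeft (b.basis W (k.trans h)) (tres M N.toPreMod k t) i
  induction t using TensorProduct.induction_on with
  | zero => simp
  | add x y hx hy =>
    rw [map_add, Finsupp.add_apply, map_add, map_add, hx, hy, map_add, Finsupp.add_apply]
  | tmul m n =>
    rw [tres_tmul, TensorProduct.equivFinsuppOfBasisLeft_apply_tmul_apply,
      TensorProduct.equivFinsuppOfBasisLeft_apply_tmul_apply, PreMod.res, N.ares_smul,
      b.rres_repr]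

lemma toTensor_right_bijective [DecidableEq ι] (b : LocalBasis M U ι) (N : ShMod A) :
    Function.Bijective (toTensor N.toPreMod M (U := U)) := by
  refine toShf_bijective (S := (tensorPre N.toPreMod M).ab) N.isSheaf (ι := ι)
    (fun i V h t => TensorProduct.equivFinsuppOfBasisRight (b.basis V h) t i) ?_ fun V h =>
      (Finsupp.equivFunOnFinite.bijective.comp
        (TensorProduct.equivFinsuppOfBasisRight (b.basis V h)).bijective)
  intro i V W h k t
  change N.res k (TensorProduct.equivFinsuppOfBasisRight (b.basis V h) t i) =
    TensorProduct.equivFinsuppOfBasisRight (b.basis W (k.trans h)) (tres N.toPreMod M k t) i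
  induction t using TensorProduct.induction_on with
  | zero => simp
  | add x y hx hy =>
    rw [map_add, Finsupp.add_apply, map_add, map_add, hx, hy, map_add, Finsupp.add_apply]
  | tmul m n =>
    rw [tres_tmul, TensorProduct.equivFinsuppOfBasisRight_apply_tmul_apply,
      TensorProduct.equivFinsuppOfBasisRight_apply_tmul_apply, PreMod.res, N.ares_smul,
      b.rres_repr]

/-- Sections of `M ⊗_A N` are uniquely of the form `∑ i, e_i ⊗ ω_i` for a basis `e_i` of `M`. -/
lemma sum_left_bijective [DecidableEq ι] (b : LocalBasis M U ι) (N : ShMod A) :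
    Function.Bijective fun ω : ι → N.Sec U =>
      toTensor M N.toPreMod (∑ i, b.basis U le_rfl i ⊗ₜ ω i) := by
  refine (b.toTensor_left_bijective N).comp ?_
  convert (TensorProduct.equivFinsuppOfBasisLeft (N := N.Sec U)
    (b.basis U le_rfl)).symm.bijective.comp
    (Finsupp.equivFunOnFinite (α := ι) (M := N.Sec U)).symm.bijective using 2 with ω
  simp [TensorProduct.equivFinsuppOfBasisLeft_symm_apply, Finsupp.sum_fintype]

lemma sum_right_bijective [DecidableEq ι] (b : LocalBasis M U ι) (N : ShMod A) :
    Function.Bijective fun ω : ι → N.Sec U =>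
      toTensor N.toPreMod M (∑ i, ω i ⊗ₜ b.basis U le_rfl i) := by
  refine (b.toTensor_right_bijective N).comp ?_
  convert (TensorProduct.equivFinsuppOfBasisRight (M := N.Sec U)
    (b.basis U le_rfl)).symm.bijective.comp
    (Finsupp.equivFunOnFinite (α := ι) (M := N.Sec U)).symm.bijective using 2 with ω
  simp [TensorProduct.equivFinsuppOfBasisRight_symm_apply, Finsupp.sum_fintype]

end LocalBasis

/-- The basis of `M_n(A)` given by the matrix units. -/
noncomputable def matBasis (A : X.Sheaf CommRingCat.{u}) (n : ℕ) (U : Opens X) :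
    LocalBasis (matMod A n) U (Fin n × Fin n) where
  basis V _ := (Matrix.stdBasis (RSec A V) (Fin n) (Fin n)).map (matSec A n V)
  res_basis V W h k i := by
    obtain ⟨i, j⟩ := i
    rw [Module.Basis.map_apply, Module.Basis.map_apply]
    erw [Matrix.stdBasis_eq_single, Matrix.stdBasis_eq_single]
    change (Matrix.single i j (1 : RSec A V)).map (rres A k) = Matrix.single i j 1
    rw [Matrix.map_single, map_one]

lemma matBasis_apply (A : X.Sheaf CommRingCat.{u}) (n : ℕ) {U V : Opens X} (h : V ≤ U)
    (i j : Fin n) :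
    (matBasis A n U).basis V h (i, j) = matSec A n V (Matrix.single i j 1) :=
  congrArg (matSec A n V) (Matrix.stdBasis_eq_single _ i j)

end Frames

/-! ### Functoriality of `1 ⊗ f` on sheafified tensor products -/

section OneTensor

variable {X : TopCat.{u}} {A : X.Sheaf CommRingCat.{u}} (M : PreMod A) {N N' N'' : PreMod A}
  {U : Opens X}

lemma res_toTensor (M N : PreMod A) {U V : Opens X} (h : V ≤ U)
    (t : M.Sec U ⊗[RSec A U] N.Sec U) :
    (tensor M N).res h (toTensor M N t) = toTensor M N (tres M N h t) :=
  ares_toShf (tensorPre M N).ab h t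

lemma tensor_ext_of {M N : PreMod A} {F : ShMod A} (x : (tensor M N).Sec U) (y z : F.Sec U)
    (h : ∀ (V : Opens X) (h : V ≤ U) (t : M.Sec V ⊗[RSec A V] N.Sec V),
      toTensor M N t = (tensor M N).res h x → F.res h y = F.res h z) : y = z :=
  ext_of_shf (T := (tensorPre M N).ab) F.isSheaf x y z h

section

variable (f : ∀ V : Opens X, V ≤ U → N.Sec V →ₗ[RSec A V] N'.Sec V)
  (hf : ∀ (V W : Opens X) (h : V ≤ U) (k : W ≤ V) (x : N.Sec V),
    N'.res k (f V h x) = f W (k.trans h) (N.res k x))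

/-- The local characterisation of `1 ⊗ f`, through which its other properties are reduced to
unsheafified tensors. -/
lemma res_oneTensor_of_eq (x : (tensor M N).Sec U) (V : Opens X) (h : V ≤ U)
    (t : M.Sec V ⊗[RSec A V] N.Sec V) (ht : toTensor M N t = (tensor M N).res h x) :
    (tensor M N').res h (oneTensor M f hf x) =
      toTensor M N' ((f V h).lTensor (M.Sec V) t) :=
  extend_spec (T := (tensorPre M N).ab) (F := (tensor M N').ab) (tensor M N').isSheaf _ _ x V h t ht

lemma oneTensor_toTensor (t : M.Sec U ⊗[RSec A U] N.Sec U) :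
    oneTensor M f hf (toTensor M N t) = toTensor M N' ((f U le_rfl).lTensor (M.Sec U) t) := by
  have := res_oneTensor_of_eq M f hf (toTensor M N t) U le_rfl t (ares_self _ _ _).symm
  rwa [PreMod.res, ares_self] at this

lemma oneTensor_add (x y : (tensor M N).Sec U) :
    oneTensor M f hf (x + y) = oneTensor M f hf x + oneTensor M f hf y := by
  refine tensor_ext_of x _ _ fun V h t ht => ?_
  -- `x` has a representative over `V`; passing to `W ≤ V` provides one for `y` as well, so both are
  -- represented over a common open set.
  refine tensor_ext_of ((tensor M N).res h y) _ _ fun W k s hs => ?_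
  have hs' : toTensor M N s = (tensor M N).res (k.trans h) y := hs.trans (ares_ares _ _ _ _)
  have ht' : toTensor M N (tres M N k t) = (tensor M N).res (k.trans h) x := by
    rw [← res_toTensor, ht]
    exact ares_ares _ _ _ _
  rw [PreMod.res, PreMod.res, ares_ares, ares_ares]
  change (tensor M N').res _ _ = (tensor M N').res _ _
  rw [map_add, res_oneTensor_of_eq M f hf x W _ _ ht', res_oneTensor_of_eq M f hf y W _ _ hs',
    res_oneTensor_of_eq M f hf (x + y) W _ (tres M N k t + s) (by rw [map_add, map_add, ht', hs']),
    map_add, map_add]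

lemma res_oneTensor {V : Opens X} (h : V ≤ U) (x : (tensor M N).Sec U) :
    (tensor M N').res h (oneTensor M f hf x) =
      oneTensor M (fun W k => f W (k.trans h)) (fun W W' k k' => hf W W' (k.trans h) k')
        ((tensor M N).res h x) := by
  refine tensor_ext_of ((tensor M N).res h x) _ _ fun W k t ht => ?_
  rw [res_oneTensor_of_eq _ _ _ _ _ _ t ht, PreMod.res, PreMod.res, ares_ares]
  exact res_oneTensor_of_eq M f hf x W _ t (ht.trans (ares_ares _ _ _ _))

lemma oneTensor_oneTensor (f' : ∀ V : Opens X, V ≤ U → N'.Sec V →ₗ[RSec A V] N''.Sec V)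
    (hf' : ∀ (V W : Opens X) (h : V ≤ U) (k : W ≤ V) (x : N'.Sec V),
      N''.res k (f' V h x) = f' W (k.trans h) (N'.res k x)) (x : (tensor M N).Sec U) :
    oneTensor M f' hf' (oneTensor M f hf x) =
      oneTensor M (fun V h => f' V h ∘ₗ f V h)
        (fun V W h k x => by
          rw [LinearMap.comp_apply, LinearMap.comp_apply, hf', hf]) x := by
  refine tensor_ext_of x _ _ fun V h t ht => ?_
  rw [res_oneTensor_of_eq _ _ _ x _ _ t ht, res_oneTensor_of_eq _ _ _ _ _ _ _
    (res_oneTensor_of_eq _ f hf x _ _ t ht).symm, LinearMap.lTensor_comp_apply]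

lemma oneTensor_congr (f' : ∀ V : Opens X, V ≤ U → N.Sec V →ₗ[RSec A V] N'.Sec V)
    (hf' : ∀ (V W : Opens X) (h : V ≤ U) (k : W ≤ V) (x : N.Sec V),
      N'.res k (f' V h x) = f' W (k.trans h) (N.res k x)) (e : ∀ V h x, f V h x = f' V h x)
    (x : (tensor M N).Sec U) : oneTensor M f hf x = oneTensor M f' hf' x := by
  obtain rfl : f = f' := funext fun V => funext fun h => LinearMap.ext (e V h)
  rfl

end

lemma oneTensor_eq_self (f : ∀ V : Opens X, V ≤ U → N.Sec V →ₗ[RSec A V] N.Sec V)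
    (hf : ∀ (V W : Opens X) (h : V ≤ U) (k : W ≤ V) (x : N.Sec V),
      N.res k (f V h x) = f W (k.trans h) (N.res k x)) (e : ∀ V h x, f V h x = x)
    (x : (tensor M N).Sec U) : oneTensor M f hf x = x := by
  refine tensor_ext_of x _ _ fun V h t ht => ?_
  obtain e : f V h = LinearMap.id := LinearMap.ext (e V h)
  rw [res_oneTensor_of_eq _ _ _ x _ _ t ht, e, LinearMap.lTensor_id, LinearMap.id_apply, ht]

end OneTensor

/-! ### Scalar matrices acting on matrices of vectors -/

section MatrixAction

variable {R M : Type*} [CommRing R] [AddCommGroup M] [Module R M] {n : ℕ}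

/-- The product `a · θ` of a matrix of scalars with a matrix of vectors. -/
def lmul (a : Matrix (Fin n) (Fin n) R) (θ : Matrix (Fin n) (Fin n) M) :
    Matrix (Fin n) (Fin n) M :=
  fun i j => ∑ k, a i k • θ k j

/-- The product `θ · a` of a matrix of vectors with a matrix of scalars. -/
def rmul (θ : Matrix (Fin n) (Fin n) M) (a : Matrix (Fin n) (Fin n) R) :
    Matrix (Fin n) (Fin n) M :=
  fun i j => ∑ k, a k j • θ i k

lemma lmul_lmul (a b : Matrix (Fin n) (Fin n) R) (θ : Matrix (Fin n) (Fin n) M) :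
    lmul a (lmul b θ) = lmul (a * b) θ := by
  ext i j
  simp only [lmul, Matrix.mul_apply, Finset.smul_sum, Finset.sum_smul, smul_smul]
  exact Finset.sum_comm

lemma one_lmul (θ : Matrix (Fin n) (Fin n) M) : lmul (1 : Matrix (Fin n) (Fin n) R) θ = θ := by
  ext i j
  simp [lmul, Matrix.one_apply]

lemma lmul_add (a : Matrix (Fin n) (Fin n) R) (θ θ' : Matrix (Fin n) (Fin n) M) :
    lmul a (θ + θ') = lmul a θ + lmul a θ' := by
  ext i j
  simp [lmul, Finset.sum_add_distrib]

end MatrixAction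

/-! ### Matrix-valued forms, and principal connections as matrices -/

section

variable {X : TopCat.{u}} {K : Type v} [Field K] {T : Triad K X} {n : ℕ} {U : Opens X}

namespace Triad

/-- Expand each `m i j` in matrix units and move the scalars across the tensor sign. This puts any
image of `∑ θ_ij ⊗ E_ij` under a linear map of the second factor back into matrix form. -/
lemma toTensor_sum_tmul_matSec (θ : Matrix (Fin n) (Fin n) (T.Ω.Sec U))
    (m : Fin n → Fin n → Matrix (Fin n) (Fin n) (RSec T.A U)) :
    toTensor T.Ω.toPreMod (matMod T.A n) (∑ i, ∑ j, θ i j ⊗ₜ matSec T.A n U (m i j)) =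
      T.ofMatrix (fun k l => ∑ i, ∑ j, m i j k l • θ i j) := by
  refine congrArg _ ?_
  have key : ∀ i j, θ i j ⊗ₜ[RSec T.A U] matSec T.A n U (m i j) =
      ∑ k, ∑ l, (m i j k l • θ i j) ⊗ₜ matSec T.A n U (Matrix.single k l 1) := fun i j => by
    conv_lhs => rw [Matrix.matrix_eq_sum_single (m i j)]
    simp only [map_sum, TensorProduct.tmul_sum]
    refine Finset.sum_congr rfl fun k _ => Finset.sum_congr rfl fun l _ => ?_
    rw [TensorProduct.smul_tmul, ← map_smul, Matrix.smul_single, smul_eq_mul, mul_one]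
  simp only [key, TensorProduct.sum_tmul]
  -- Grouping the four indices into two pairs reduces the exchange of summations to a single swap.
  calc _ = ∑ p : Fin n × Fin n, ∑ q : Fin n × Fin n, (m p.1 p.2 q.1 q.2 • θ p.1 p.2) ⊗ₜ
        matSec T.A n U (Matrix.single q.1 q.2 1) := by simp only [Fintype.sum_prod_type]
    _ = _ := by rw [Finset.sum_comm]; simp only [Fintype.sum_prod_type]

/-- `M_n(A)` is free on the matrix units, so `sum_right_bijective` applies; currying turns families
indexed by pairs into matrices. -/
lemma ofMatrix_bijective :
    Function.Bijective (T.ofMatrix : Matrix (Fin n) (Fin n) (T.Ω.Sec U) → _) := by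
  have := ((matBasis T.A n U).sum_right_bijective T.Ω).comp
    (Equiv.curry (Fin n) (Fin n) (T.Ω.Sec U)).symm.bijective
  refine (congrArg Function.Bijective (funext fun θ => ?_)).mp this
  simp only [ofMatrix, Fintype.sum_prod_type, matBasis_apply]
  rfl

lemma ofMatrix_add (θ θ' : Matrix (Fin n) (Fin n) (T.Ω.Sec U)) :
    T.ofMatrix (θ + θ') = T.ofMatrix θ + T.ofMatrix θ' := by
  simp only [ofMatrix, Matrix.add_apply, TensorProduct.add_tmul, Finset.sum_add_distrib, map_add]

lemma res_ofMatrix {V : Opens X} (h : V ≤ U) (θ : Matrix (Fin n) (Fin n) (T.Ω.Sec U)) :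
    (tensor T.Ω.toPreMod (matMod T.A n)).res h (T.ofMatrix θ) =
      T.ofMatrix (θ.map (T.Ω.res h)) := by
  rw [ofMatrix, res_toTensor]
  simp only [ofMatrix, map_sum, tres_tmul]
  refine Finset.sum_congr rfl fun i _ => Finset.sum_congr rfl fun j _ =>
    congrArg (fun m => toTensor T.Ω.toPreMod (matMod T.A n) (T.Ω.res h (θ i j) ⊗ₜ m)) ?_
  change (Matrix.single i j (1 : RSec T.A U)).map (rres T.A h) = Matrix.single i j 1
  rw [Matrix.map_single, map_one]

lemma mcGL_eq (a : GL (Fin n) (RSec T.A U)) :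
    T.mcGL a = T.ofMatrix (lmul (a⁻¹).1 (a.1.map (T.d U))) := by
  refine (toTensor_sum_tmul_matSec (a.1.map (T.d U))
    fun i j => a⁻¹.1 * Matrix.single i j 1).trans ?_
  congr 1
  ext k l
  rw [lmul]
  refine Finset.sum_congr rfl fun i _ => ?_
  -- `a⁻¹ E_ij` is supported in column `j`, so only `j = l` contributes to the entry `(k, l)`.
  rw [Finset.sum_eq_single l]
  · simp
  · intro j _ hj
    rw [Matrix.mul_single_apply_of_ne _ _ _ _ _ hj.symm, zero_smul]
  · simp

end Triad

/-- The morphism `m ↦ a m b` of `M_n(A)|_U`. -/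
noncomputable def mulLeftRight (A : X.Sheaf CommRingCat.{u})
    (a b : Matrix (Fin n) (Fin n) (RSec A U)) (V : Opens X) (h : V ≤ U) :
    (matMod A n).Sec V →ₗ[RSec A V] (matMod A n).Sec V :=
  (matSec A n V).toLinearMap ∘ₗ LinearMap.mulLeftRight (RSec A V)
    (a.map (rres A h), b.map (rres A h)) ∘ₗ (matSec A n V).symm.toLinearMap

lemma res_mulLeftRight (A : X.Sheaf CommRingCat.{u}) (a b : Matrix (Fin n) (Fin n) (RSec A U))
    (V W : Opens X) (h : V ≤ U) (k : W ≤ V) (x : (matMod A n).Sec V) :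
    (matMod A n).res k (mulLeftRight A a b V h x) =
      mulLeftRight A a b W (k.trans h) ((matMod A n).res k x) := by
  change (rres A k).mapMatrix (a.map (rres A h) * (matSec A n V).symm x * b.map (rres A h)) =
    a.map (rres A (k.trans h)) * (rres A k).mapMatrix ((matSec A n V).symm x) *
      b.map (rres A (k.trans h))
  have e (c : Matrix (Fin n) (Fin n) (RSec A U)) :
      (rres A k).mapMatrix (c.map (rres A h)) = c.map (rres A (k.trans h)) :=
    Matrix.ext fun i j => rres_rres A h k (c i j)
  rw [map_mul, map_mul, e, e]

/-- The `(k, l)` entry of `a E_ij b` is `a_ki b_jl`, so the new coefficient is `∑ a_ki b_jl θ_ij`.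
With `b = a⁻¹` this is the adjoint action on matrices of forms. -/
lemma oneTensor_mulLeftRight (a b : Matrix (Fin n) (Fin n) (RSec T.A U))
    (θ : Matrix (Fin n) (Fin n) (T.Ω.Sec U)) :
    oneTensor T.Ω.toPreMod (mulLeftRight T.A a b) (res_mulLeftRight T.A a b) (T.ofMatrix θ) =
      T.ofMatrix (lmul a (rmul θ b)) := by
  rw [Triad.ofMatrix, oneTensor_toTensor]
  simp only [map_sum (LinearMap.lTensor _ _), LinearMap.lTensor_tmul]
  have e : ∀ i j, mulLeftRight T.A a b U le_rfl (matSec T.A n U (Matrix.single i j 1)) =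
      matSec T.A n U (a * Matrix.single i j 1 * b) := fun i j => by
    change a.map (rres T.A le_rfl) * _ * b.map (rres T.A le_rfl) = a * _ * b
    have h (c : Matrix (Fin n) (Fin n) (RSec T.A U)) : c.map (rres T.A le_rfl) = c := by
      ext i j
      exact rres_self _ _ _
    rw [h, h]
    rfl
  simp only [e]
  rw [Triad.toTensor_sum_tmul_matSec]
  congr 1
  ext k l
  simp only [lmul, rmul, Finset.smul_sum, smul_smul]
  refine Finset.sum_congr rfl fun i _ => Finset.sum_congr rfl fun j _ => ?_
  rw [Matrix.mul_apply, Finset.sum_eq_single j]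
  · simp
  · intro m _ hm
    rw [Matrix.mul_single_apply_of_ne _ _ _ _ _ hm, zero_mul]
  · simp

namespace LieMor

variable {A : X.Sheaf CommRingCat.{u}} {L : LieSheaf A} (f : LieMor L n)

lemma oneTensor_add (M : PreMod A) (x y : (tensor M L.toPreMod).Sec U) :
    f.oneTensor M (x + y) = f.oneTensor M x + f.oneTensor M y :=
  AssocSheaf.oneTensor_add _ _ _ _ _

lemma res_oneTensor (M : PreMod A) {V : Opens X} (h : V ≤ U) (x : (tensor M L.toPreMod).Sec U) :
    (tensor M (matMod A n)).res h (f.oneTensor M x) =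
      f.oneTensor M ((tensor M L.toPreMod).res h x) :=
  AssocSheaf.res_oneTensor _ _ _ _ _

/-- The sectionwise inverses of `f` commute with restriction, so they induce a map `1 ⊗ f⁻¹`, which
is inverse to `1 ⊗ f` by functoriality. -/
lemma oneTensor_bijective (hf : ∀ U : Opens X, Function.Bijective (f.hom U)) (M : PreMod A) :
    Function.Bijective (f.oneTensor M (U := U)) := by
  let g : ∀ V : Opens X, V ≤ U → (matMod A n).Sec V →ₗ[RSec A V] L.Sec V := fun V _ =>
    (LinearEquiv.ofBijective (f.hom V) (hf V)).symm.toLinearMap ∘ₗ (matSec A n V).symm.toLinearMap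
  have fg : ∀ (V : Opens X) (h : V ≤ U) (x : (matMod A n).Sec V), f.hom V (g V h x) = x :=
    fun V h x => (LinearEquiv.ofBijective (f.hom V) (hf V)).apply_symm_apply x
  have gf : ∀ (V : Opens X) (h : V ≤ U) (x : L.Sec V), g V h (f.hom V x) = x :=
    fun V h x => (LinearEquiv.ofBijective (f.hom V) (hf V)).symm_apply_apply x
  have hg : ∀ (V W : Opens X) (h : V ≤ U) (k : W ≤ V) (x : (matMod A n).Sec V),
      L.res k (g V h x) = g W (k.trans h) ((matMod A n).res k x) := fun V W h k x => by
    -- Naturality of the inverse follows from that of `f` after applying the injective map `f.hom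
    -- W`.
    refine (hf W).1 ?_
    rw [fg W (k.trans h), ← f.res_hom k, fg V h]
    rfl
  refine Function.bijective_iff_has_inverse.2 ⟨AssocSheaf.oneTensor M g hg, fun x => ?_, fun x => ?_⟩
  · exact (oneTensor_oneTensor _ _ _ _ _ _).trans (oneTensor_eq_self _ _ _ gf x)
  · exact (oneTensor_oneTensor _ _ _ _ _ _).trans (oneTensor_eq_self _ _ _ fg x)

end LieMor

variable {𝒢 : LieTypeGroup T} {φ : Rep T.A 𝒢.G n} {φbar : LieMor 𝒢.L n}

/-- Both sides have the form `1 ⊗ (composite)`, so it suffices to compare the composites on sections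
over each `V ≤ U`. There the identity is `φ̄ ∘ ϱ(g|_V) = Ad(φ(g|_V)) ∘ φ̄`. -/
lemma IsLieType.oneTensor_act (hφ : IsLieType 𝒢 φ φbar) (g : GSec 𝒢.G U)
    (ω : (tensor T.Ω.toPreMod 𝒢.L.toPreMod).Sec U) :
    φbar.oneTensor T.Ω.toPreMod (𝒢.ϱ.act T.Ω.toPreMod g ω) =
      oneTensor T.Ω.toPreMod (mulLeftRight T.A (φ.hom U g).1 (φ.hom U g)⁻¹.1)
        (res_mulLeftRight T.A _ _) (φbar.oneTensor T.Ω.toPreMod ω) := by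
  refine (oneTensor_oneTensor _ _ _ _ _ _).trans (Eq.trans ?_
    (oneTensor_oneTensor _ _ _ _ _ _).symm)
  refine oneTensor_congr _ _ _ _ _ (fun V h x => ?_) ω
  refine (hφ.hom_ϱ V (gres 𝒢.G h g) x).trans ?_
  rw [← φ.res_hom h g, ← map_inv]
  rfl

/-- Connection matrices on a principal sheaf: a family of matrices `θ_s` of sections of `Ω¹`, one for
each local section `s` of `P`, compatible with restriction and such that
`θ_{s · g} = φ(g)⁻¹ (θ_s φ(g) + d φ(g))`. -/
@[ext]
structure ConnectionMatrices {G : X.Sheaf GrpCat.{u}} (P : PrincipalSheaf G)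
    (φ : Rep T.A G n) where
  θ : ∀ U : Opens X, P.Sec U → Matrix (Fin n) (Fin n) (T.Ω.Sec U)
  res_θ : ∀ {U V : Opens X} (h : V ≤ U) (s : P.Sec U),
    (θ U s).map (T.Ω.res h) = θ V (P.res h s)
  θ_act : ∀ (U : Opens X) (s : P.Sec U) (g : GSec G U),
    θ U (P.act s g) = lmul (φ.hom U g)⁻¹.1
      (rmul (θ U s) (φ.hom U g).1 + (φ.hom U g).1.map (T.d U))

/-- The identification of `Ω¹ ⊗_A L` with the matrices of sections of `Ω¹` given by `1 ⊗ φ̄`. -/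
noncomputable def matrixEquiv (hiso : ∀ U : Opens X, Function.Bijective (φbar.hom U))
    (U : Opens X) :
    (tensor T.Ω.toPreMod 𝒢.L.toPreMod).Sec U ≃ Matrix (Fin n) (Fin n) (T.Ω.Sec U) :=
  (Equiv.ofBijective (φbar.oneTensor T.Ω.toPreMod)
    (φbar.oneTensor_bijective hiso T.Ω.toPreMod)).trans
    (Equiv.ofBijective T.ofMatrix T.ofMatrix_bijective).symm

lemma matrixEquiv_eq_iff (hiso : ∀ U : Opens X, Function.Bijective (φbar.hom U))
    (ω : (tensor T.Ω.toPreMod 𝒢.L.toPreMod).Sec U) (θ : Matrix (Fin n) (Fin n) (T.Ω.Sec U)) :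
    matrixEquiv hiso U ω = θ ↔ φbar.oneTensor T.Ω.toPreMod ω = T.ofMatrix θ := by
  rw [matrixEquiv, Equiv.trans_apply, Equiv.symm_apply_eq, Equiv.ofBijective_apply,
    Equiv.ofBijective_apply]

lemma ofMatrix_matrixEquiv (hiso : ∀ U : Opens X, Function.Bijective (φbar.hom U))
    (ω : (tensor T.Ω.toPreMod 𝒢.L.toPreMod).Sec U) :
    T.ofMatrix (matrixEquiv hiso U ω) = φbar.oneTensor T.Ω.toPreMod ω :=
  ((matrixEquiv_eq_iff hiso ω _).1 rfl).symm

lemma map_matrixEquiv (hiso : ∀ U : Opens X, Function.Bijective (φbar.hom U)) {V : Opens X}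
    (h : V ≤ U) (ω : (tensor T.Ω.toPreMod 𝒢.L.toPreMod).Sec U) :
    (matrixEquiv hiso U ω).map (T.Ω.res h) =
      matrixEquiv hiso V ((tensor T.Ω.toPreMod 𝒢.L.toPreMod).res h ω) := by
  refine Eq.symm ((matrixEquiv_eq_iff hiso _ _).2 ?_)
  rw [← Triad.res_ofMatrix, ofMatrix_matrixEquiv, LieMor.res_oneTensor]

/-- Where the Lie type hypothesis enters: its `ϱ` condition makes the first summand `φ(g)⁻¹ θ φ(g)`,
its Maurer-Cartan condition makes the second `φ(g)⁻¹ dφ(g)`, and `φ(g)⁻¹` factors out. The resulting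
equality serves both directions of `principalEquiv`. -/
lemma matrixEquiv_act_add_mc (hφ : IsLieType 𝒢 φ φbar)
    (hiso : ∀ U : Opens X, Function.Bijective (φbar.hom U)) (g : GSec 𝒢.G U)
    (ω : (tensor T.Ω.toPreMod 𝒢.L.toPreMod).Sec U) :
    matrixEquiv hiso U (𝒢.ϱ.act T.Ω.toPreMod g⁻¹ ω + 𝒢.mc U g) =
      lmul (φ.hom U g)⁻¹.1
        (rmul (matrixEquiv hiso U ω) (φ.hom U g).1 + (φ.hom U g).1.map (T.d U)) := by
  rw [matrixEquiv_eq_iff, LieMor.oneTensor_add, ← hφ.mcGL_hom, Triad.mcGL_eq, hφ.oneTensor_act,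
    ← ofMatrix_matrixEquiv hiso, oneTensor_mulLeftRight, ← Triad.ofMatrix_add, map_inv, inv_inv,
    lmul_add]

/-- Connections on `P` correspond to connection matrices. -/
noncomputable def principalEquiv (P : PrincipalSheaf 𝒢.G) (hφ : IsLieType 𝒢 φ φbar)
    (hiso : ∀ U : Opens X, Function.Bijective (φbar.hom U)) :
    PrincipalConnection P ≃ ConnectionMatrices P φ where
  toFun D :=
    { θ := fun U s => matrixEquiv hiso U (D.D U s)
      res_θ := fun h s => by rw [map_matrixEquiv, D.res_D]
      θ_act := fun U s g => by rw [D.D_act, matrixEquiv_act_add_mc hφ] }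
  invFun c :=
    { D := fun U s => (matrixEquiv hiso U).symm (c.θ U s)
      res_D := fun h s => by
        rw [Equiv.eq_symm_apply, ← map_matrixEquiv, Equiv.apply_symm_apply, c.res_θ]
      D_act := fun U s g => by
        rw [Equiv.symm_apply_eq, matrixEquiv_act_add_mc hφ, Equiv.apply_symm_apply, c.θ_act] }
  left_inv D := by
    ext U s
    exact Equiv.symm_apply_apply _ _
  right_inv c := by
    ext U s : 3
    exact Equiv.apply_symm_apply _ _

lemma ofMatrix_principalEquiv {P : PrincipalSheaf 𝒢.G} (hφ : IsLieType 𝒢 φ φbar)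
    (hiso : ∀ U : Opens X, Function.Bijective (φbar.hom U)) (D : PrincipalConnection P)
    (s : P.Sec U) :
    T.ofMatrix ((principalEquiv P hφ hiso D).θ U s) = φbar.oneTensor T.Ω.toPreMod (D.D U s) :=
  ofMatrix_matrixEquiv hiso _

end

/-! ### Frames of the associated sheaf -/

section

variable {X : TopCat.{u}} {A : X.Sheaf CommRingCat.{u}} {G : X.Sheaf GrpCat.{u}} {n : ℕ}

/-- A local trivialisation pulls the unit section of `G` back to `P`. Since `P` need not have
sections over `U` itself, later arguments on arbitrary opens localise through this. -/
lemma PrincipalSheaf.exists_section (P : PrincipalSheaf G) {U : Opens X} {x : X} (hx : x ∈ U) :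
    ∃ V : Opens X, V ≤ U ∧ x ∈ V ∧ Nonempty (P.Sec V) := by
  obtain ⟨W, hxW, ⟨ψ⟩⟩ := P.locally_trivial x
  exact ⟨U ⊓ W, inf_le_left, ⟨hx, hxW⟩, ⟨(ψ.equiv _ inf_le_right).symm 1⟩⟩

variable (P : PrincipalSheaf G) (φ : Rep A G n) {U V : Opens X}

lemma res_assocMk (h : V ≤ U) (s : P.Sec U) (a : Fin n → RSec A U) :
    (assoc P φ).res h (assocMk P φ s a) = assocMk P φ (P.res h s) (rres A h ∘ a) :=
  sres_cls P φ h s a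

lemma res_assocBasis (h : V ≤ U) (s : P.Sec U) (j : Fin n) :
    (assoc P φ).res h (assocBasis P φ s j) = assocBasis P φ (P.res h s) j := by
  rw [assocBasis, res_assocMk]
  refine congrArg (assocMk P φ (P.res h s)) (funext fun i => ?_)
  rw [Function.comp_apply, Pi.single_apply, Pi.single_apply]
  split_ifs
  exacts [map_one _, map_zero _]

lemma assocMk_eq_sum (s : P.Sec U) (a : Fin n → RSec A U) :
    assocMk P φ s a = ∑ j, a j • assocBasis P φ s j := by
  conv_lhs => rw [pi_eq_sum_univ' a, map_sum]
  refine Finset.sum_congr rfl fun j _ => ?_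
  rw [map_smul, assocBasis]

/-- The coordinates of a section of the associated sheaf in the basis attached to `s`. -/
noncomputable def assocCoord (s : P.Sec U) (y : (assoc P φ).Sec U) : Fin n → RSec A U :=
  (assocMk P φ s).symm y

lemma assocMk_assocCoord (s : P.Sec U) (y : (assoc P φ).Sec U) :
    assocMk P φ s (assocCoord P φ s y) = y :=
  (assocMk P φ s).apply_symm_apply y

lemma assocCoord_res (h : V ≤ U) (s : P.Sec U) (y : (assoc P φ).Sec U) :
    assocCoord P φ (P.res h s) ((assoc P φ).res h y) = rres A h ∘ assocCoord P φ s y := by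
  rw [assocCoord, LinearEquiv.symm_apply_eq, ← res_assocMk, assocMk_assocCoord]

lemma assocMk_act (s : P.Sec U) (g : GSec G U) (a : Fin n → RSec A U) :
    assocMk P φ (P.act s g) a = assocMk P φ s (φ.mulVec g a) :=
  cls_act P φ s g a

/-- Change of coordinates, read off from `[s·g, a] = [s, φ(g) a]`. -/
lemma assocCoord_eq_mulVec (s : P.Sec U) (g : GSec G U) (y : (assoc P φ).Sec U) :
    assocCoord P φ s y = φ.mulVec g (assocCoord P φ (P.act s g) y) := by
  rw [assocCoord, LinearEquiv.symm_apply_eq, ← assocMk_act, assocMk_assocCoord]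

lemma assocBasis_act (s : P.Sec U) (g : GSec G U) (j : Fin n) :
    assocBasis P φ (P.act s g) j = ∑ i, (φ.hom U g).1 i j • assocBasis P φ s i := by
  rw [assocBasis, assocMk_act, assocMk_eq_sum]
  simp [Rep.mulVec]

/-- The basis of the associated sheaf over `U` attached to a section of `P` over `U`. -/
noncomputable def assocLocalBasis (s : P.Sec U) :
    LocalBasis (assoc P φ).toPreMod U (Fin n) where
  basis V h := (Pi.basisFun (RSec A V) (Fin n)).map (assocMk P φ (P.res h s))
  res_basis V W h k i := by
    have e (V : Opens X) (h : V ≤ U) : ((Pi.basisFun (RSec A V) (Fin n)).map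
        (assocMk P φ (P.res h s))) i = assocBasis P φ (P.res h s) i := by
      rw [Module.Basis.map_apply, Pi.basisFun_apply, assocBasis]
    rw [e, e, res_assocBasis, PrincipalSheaf.res, sres_sres]

lemma assocLocalBasis_apply (s : P.Sec U) (i : Fin n) :
    (assocLocalBasis P φ s).basis U le_rfl i = assocBasis P φ s i := by
  rw [assocLocalBasis, Module.Basis.map_apply, Pi.basisFun_apply, assocBasis, PrincipalSheaf.res,
    sres_self]

/-- The section `∑ i, e_i ⊗ ω_i` of `E ⊗_A Ω`, where `e_i` is the basis of `E` attached to `s`. -/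
noncomputable def frameForm (Ω : PreMod A) (s : P.Sec U) :
    (Fin n → Ω.Sec U) →ₗ[RSec A U] (tensor (assoc P φ).toPreMod Ω).Sec U :=
  ∑ i, toTensor (assoc P φ).toPreMod Ω ∘ₗ
    TensorProduct.mk (RSec A U) _ _ (assocBasis P φ s i) ∘ₗ LinearMap.proj i

lemma frameForm_apply (Ω : PreMod A) (s : P.Sec U) (ω : Fin n → Ω.Sec U) :
    frameForm P φ Ω s ω =
      ∑ i, toTensor (assoc P φ).toPreMod Ω (assocBasis P φ s i ⊗ₜ ω i) := by
  simp [frameForm]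

/-- A section of `P` over `U` makes `E` free over `U`, so sections of `E ⊗ Ω` need no sheafification
there. This is what allows a connection matrix to be read off from `∇(e_j)`. -/
lemma frameForm_bijective (Ω : ShMod A) (s : P.Sec U) :
    Function.Bijective (frameForm P φ Ω.toPreMod s) := by
  refine (congrArg Function.Bijective (funext fun ω => ?_)).mp
    ((assocLocalBasis P φ s).sum_left_bijective Ω)
  rw [frameForm_apply, map_sum]
  simp only [assocLocalBasis_apply]

lemma res_frameForm (Ω : PreMod A) (h : V ≤ U) (s : P.Sec U) (ω : Fin n → Ω.Sec U) :
    (tensor (assoc P φ).toPreMod Ω).res h (frameForm P φ Ω s ω) =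
      frameForm P φ Ω (P.res h s) fun i => Ω.res h (ω i) := by
  rw [frameForm_apply, frameForm_apply, map_sum]
  refine Finset.sum_congr rfl fun i _ => ?_
  rw [res_toTensor, tres_tmul, res_assocBasis]

lemma frameForm_act (Ω : PreMod A) (s : P.Sec U) (g : GSec G U) (ω : Fin n → Ω.Sec U) :
    frameForm P φ Ω (P.act s g) ω =
      frameForm P φ Ω s fun i => ∑ j, (φ.hom U g).1 i j • ω j := by
  rw [frameForm_apply, frameForm_apply]
  simp only [assocBasis_act, TensorProduct.sum_tmul, TensorProduct.tmul_sum, map_sum,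
    TensorProduct.smul_tmul]
  exact Finset.sum_comm

/-- Used for the Leibniz term `y ⊗ da`, which does not mention a frame. -/
lemma toTensor_tmul_eq_frameForm (Ω : PreMod A) (s : P.Sec U) (y : (assoc P φ).Sec U)
    (ω : Ω.Sec U) :
    toTensor (assoc P φ).toPreMod Ω (y ⊗ₜ ω) =
      frameForm P φ Ω s fun i => assocCoord P φ s y i • ω := by
  rw [frameForm_apply]
  conv_lhs => rw [← assocMk_assocCoord P φ s y, assocMk_eq_sum]
  simp only [TensorProduct.sum_tmul, map_sum, TensorProduct.smul_tmul]

end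

/-! ### Linear connections on the associated sheaf as matrices -/

section

variable {X : TopCat.{u}} {K : Type v} [Field K] {T : Triad K X} {n : ℕ}
  {G : X.Sheaf GrpCat.{u}} {P : PrincipalSheaf G} {φ : Rep T.A G n} {U : Opens X}

lemma Triad.d_algebraMap (c : K) : T.d U (algebraMap K (RSec T.A U) c) = 0 := by
  have h1 : T.d U 1 = 0 := by
    have := T.d_mul U 1 1
    rw [mul_one, one_smul] at this
    -- The product rule for `1 · 1` reads `d 1 = d 1 + d 1`.
    exact left_eq_add.1 this
  rw [Algebra.algebraMap_eq_smul_one, T.d_smul, h1, smul_zero]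

lemma ShMod.ext_of_sections (P : PrincipalSheaf G) {F : ShMod T.A} {y z : F.Sec U}
    (h : ∀ (V : Opens X) (h : V ≤ U), P.Sec V → F.res h y = F.res h z) : y = z :=
  ab_ext F.isSheaf y z fun x hx => by
    obtain ⟨V, hV, hxV, ⟨s⟩⟩ := P.exists_section hx
    exact ⟨V, hV, hxV, h V hV s⟩

/-- The coordinate expression `a ↦ d a + θ a` of a connection with matrix `θ`. -/
def covariant (θ : Matrix (Fin n) (Fin n) (T.Ω.Sec U)) (a : Fin n → RSec T.A U) :
    Fin n → T.Ω.Sec U :=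
  fun i => T.d U (a i) + ∑ j, a j • θ i j

lemma covariant_add (θ : Matrix (Fin n) (Fin n) (T.Ω.Sec U)) (a b : Fin n → RSec T.A U) :
    covariant θ (a + b) = covariant θ a + covariant θ b := by
  ext i
  simp only [covariant, Pi.add_apply, map_add, add_smul, Finset.sum_add_distrib]
  abel

lemma covariant_smul (θ : Matrix (Fin n) (Fin n) (T.Ω.Sec U)) (r : RSec T.A U)
    (a : Fin n → RSec T.A U) :
    covariant θ (r • a) = r • covariant θ a + fun i => a i • T.d U r := by
  ext i
  simp only [covariant, Pi.add_apply, Pi.smul_apply, smul_eq_mul, T.d_mul, smul_add,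
    Finset.smul_sum, smul_smul]
  abel

lemma covariant_single (θ : Matrix (Fin n) (Fin n) (T.Ω.Sec U)) (j : Fin n) :
    covariant θ (Pi.single j 1) = fun i => θ i j := by
  have h1 : T.d U 1 = 0 := by rw [← map_one (algebraMap K (RSec T.A U)), Triad.d_algebraMap]
  ext i
  rw [covariant, Finset.sum_eq_single j]
  · rw [Pi.single_apply]
    split_ifs <;> simp [h1]
  · intro k _ hk
    rw [Pi.single_eq_of_ne hk, zero_smul]
  · simp

lemma res_covariant {V : Opens X} (h : V ≤ U) (θ : Matrix (Fin n) (Fin n) (T.Ω.Sec U))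
    (a : Fin n → RSec T.A U) (i : Fin n) :
    T.Ω.res h (covariant θ a i) = covariant (θ.map (T.Ω.res h)) (rres T.A h ∘ a) i := by
  simp only [covariant, map_add, map_sum, T.res_d, PreMod.res, T.Ω.ares_smul]
  rfl

/-- By the Leibniz rule `d(ma) + θma = m da + (dm + θm) a`, and the hypothesis replaces `dm + θm` by
`mθ'`. This is the gauge law with its inverse cleared, with `m = φ(g)` in the applications. -/
lemma covariant_mulVec (θ θ' : Matrix (Fin n) (Fin n) (T.Ω.Sec U))
    (m : Matrix (Fin n) (Fin n) (RSec T.A U)) (h : lmul m θ' = rmul θ m + m.map (T.d U))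
    (a : Fin n → RSec T.A U) (i : Fin n) :
    covariant θ (m.mulVec a) i = ∑ j, m i j • covariant θ' a j := by
  have h' : ∀ k, ∑ j, m i j • θ' j k = (∑ j, m j k • θ i j) + T.d U (m i k) :=
    fun k => congrFun (congrFun h i) k
  have e : ∑ j, m i j • ∑ k, a k • θ' j k = ∑ k, a k • ∑ j, m i j • θ' j k := by
    simp only [Finset.smul_sum, smul_smul]
    rw [Finset.sum_comm]
    simp only [mul_comm]
  simp only [covariant, smul_add, Finset.sum_add_distrib]
  rw [e]
  simp only [h', smul_add, Finset.sum_add_distrib, Matrix.mulVec, dotProduct, map_sum, T.d_mul,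
    Finset.sum_smul, Finset.smul_sum, smul_smul]
  rw [Finset.sum_comm (f := fun k j => (m k j * a j) • θ i k)]
  simp only [mul_comm (a _)]
  abel

lemma LinearConnection.isMatrix_iff (nb : LinearConnection T (assoc P φ)) (s : P.Sec U)
    (θ : Matrix (Fin n) (Fin n) (T.Ω.Sec U)) :
    nb.IsMatrix (assocBasis P φ s) θ ↔
      ∀ j, nb.nabla U (assocBasis P φ s j) = frameForm P φ T.Ω.toPreMod s fun i => θ i j := by
  simp only [LinearConnection.IsMatrix, frameForm_apply]

/-- Write `y = ∑ a_j e_j` and apply additivity and the Leibniz rule: the terms `e_j ⊗ da_j` and `a_j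
∇(e_j)` give `da` and `θa`. -/
lemma LinearConnection.nabla_eq (nb : LinearConnection T (assoc P φ)) (s : P.Sec U)
    {θ : Matrix (Fin n) (Fin n) (T.Ω.Sec U)} (hθ : nb.IsMatrix (assocBasis P φ s) θ)
    (y : (assoc P φ).Sec U) :
    nb.nabla U y = frameForm P φ T.Ω.toPreMod s (covariant θ (assocCoord P φ s y)) := by
  rw [nb.isMatrix_iff] at hθ
  conv_lhs => rw [← assocMk_assocCoord P φ s y, assocMk_eq_sum]
  simp only [map_sum, nb.leibniz, hθ, ← map_smul]
  have e : covariant θ (assocCoord P φ s y) = (fun i => T.d U (assocCoord P φ s y i)) +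
      ∑ j, assocCoord P φ s y j • fun i => θ i j := by
    ext i
    simp [covariant]
  rw [e, map_add, map_sum, Finset.sum_add_distrib, add_comm, frameForm_apply]

lemma LinearConnection.existsUnique_isMatrix (nb : LinearConnection T (assoc P φ))
    (s : P.Sec U) :
    ∃! θ : Matrix (Fin n) (Fin n) (T.Ω.Sec U), nb.IsMatrix (assocBasis P φ s) θ := by
  choose c hc using fun j =>
    (frameForm_bijective P φ T.Ω s).2 (nb.nabla U (assocBasis P φ s j))
  -- The components of `∇(e_j)` form the `j`-th column of the matrix, hence the transposed indices.
  refine ⟨fun i j => c j i, (nb.isMatrix_iff s _).2 fun j => (hc j).symm, fun θ hθ => ?_⟩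
  ext i j
  exact congrFun ((frameForm_bijective P φ T.Ω s).1
    (((nb.isMatrix_iff s θ).1 hθ j).symm.trans (hc j).symm)) i

lemma LinearConnection.IsMatrix.res {nb : LinearConnection T (assoc P φ)} {s : P.Sec U}
    {θ : Matrix (Fin n) (Fin n) (T.Ω.Sec U)} (hθ : nb.IsMatrix (assocBasis P φ s) θ)
    {V : Opens X} (h : V ≤ U) :
    nb.IsMatrix (assocBasis P φ (P.res h s)) (θ.map (T.Ω.res h)) := by
  rw [nb.isMatrix_iff] at hθ ⊢
  intro j
  rw [← res_assocBasis, ← nb.res_nabla, hθ, res_frameForm]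
  rfl

/-- Compute `∇` of the new basis in the old frame, then use `covariant_mulVec` with `m = φ(g)` to
return to the new frame, where the basis vectors have constant coordinates. -/
lemma LinearConnection.IsMatrix.act {nb : LinearConnection T (assoc P φ)} {s : P.Sec U}
    {θ : Matrix (Fin n) (Fin n) (T.Ω.Sec U)} (hθ : nb.IsMatrix (assocBasis P φ s) θ)
    (g : GSec G U) :
    nb.IsMatrix (assocBasis P φ (P.act s g)) (lmul (φ.hom U g)⁻¹.1
      (rmul θ (φ.hom U g).1 + (φ.hom U g).1.map (T.d U))) := by
  rw [nb.isMatrix_iff]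
  intro j
  have e : assocCoord P φ (P.act s g) (assocBasis P φ (P.act s g) j) = Pi.single j 1 :=
    (assocMk P φ (P.act s g)).symm_apply_apply _
  rw [nb.nabla_eq s hθ, assocCoord_eq_mulVec P φ s g, frameForm_act, e]
  refine congrArg _ (funext fun i => ?_)
  rw [Rep.mulVec, covariant_mulVec θ (lmul (φ.hom U g)⁻¹.1
      (rmul θ (φ.hom U g).1 + (φ.hom U g).1.map (T.d U)))]
  · rw [covariant_single]
  -- Multiplying the proposed matrix by `φ(g)` cancels its factor `φ(g)⁻¹`, leaving the hypothesis
  -- of `covariant_mulVec`.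
  · rw [lmul_lmul, ← Units.val_mul, mul_inv_cancel, Units.val_one, one_lmul]

/-- Around every point `P` has a section, and in its frame both connections are given by `da + θa`
with the same `θ`. -/
lemma LinearConnection.ext_of_isMatrix {nb nb' : LinearConnection T (assoc P φ)}
    (h : ∀ (U : Opens X) (s : P.Sec U), ∃ θ : Matrix (Fin n) (Fin n) (T.Ω.Sec U),
      nb.IsMatrix (assocBasis P φ s) θ ∧ nb'.IsMatrix (assocBasis P φ s) θ) : nb = nb' := by
  ext U y
  refine ab_ext (tensor (assoc P φ).toPreMod T.Ω.toPreMod).isSheaf _ _ fun x hx => ?_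
  obtain ⟨V, hV, hxV, ⟨s⟩⟩ := P.exists_section hx
  obtain ⟨θ, hθ, hθ'⟩ := h V s
  refine ⟨V, hV, hxV, (nb.res_nabla hV y).trans (Eq.trans ?_ (nb'.res_nabla hV y).symm)⟩
  rw [nb.nabla_eq s hθ, nb'.nabla_eq s hθ']

namespace ConnectionMatrices

variable (c : ConnectionMatrices P φ)

/-- The covariant derivative of `y` with respect to connection matrices, computed in the basis
attached to `s`. -/
noncomputable def localNabla (s : P.Sec U) (y : (assoc P φ).Sec U) :
    (tensor (assoc P φ).toPreMod T.Ω.toPreMod).Sec U :=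
  frameForm P φ T.Ω.toPreMod s (covariant (c.θ U s) (assocCoord P φ s y))

lemma res_localNabla {V : Opens X} (h : V ≤ U) (s : P.Sec U) (y : (assoc P φ).Sec U) :
    (tensor (assoc P φ).toPreMod T.Ω.toPreMod).res h (c.localNabla s y) =
      c.localNabla (P.res h s) ((assoc P φ).res h y) := by
  rw [localNabla, localNabla, res_frameForm, assocCoord_res, ← c.res_θ h]
  exact congrArg _ (funext fun i => res_covariant h _ _ i)

lemma localNabla_act (s : P.Sec U) (g : GSec G U) (y : (assoc P φ).Sec U) :
    c.localNabla (P.act s g) y = c.localNabla s y := by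
  rw [localNabla, localNabla, frameForm_act, assocCoord_eq_mulVec P φ s g]
  refine congrArg _ (funext fun i => (covariant_mulVec _ _ _ ?_ _ i).symm)
  rw [c.θ_act, lmul_lmul, ← Units.val_mul, mul_inv_cancel, Units.val_one, one_lmul]

/-- Two sections of `P` over the same open set differ by a section of `G`, so invariance under the
action gives independence of the frame. This is the gluing condition for the local derivatives. -/
lemma localNabla_congr (s t : P.Sec U) (y : (assoc P φ).Sec U) :
    c.localNabla s y = c.localNabla t y := by
  obtain ⟨g, rfl⟩ := P.exists_act_eq s t
  exact (c.localNabla_act s g y).symm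

lemma localNabla_add (s : P.Sec U) (y z : (assoc P φ).Sec U) :
    c.localNabla s (y + z) = c.localNabla s y + c.localNabla s z := by
  rw [localNabla, localNabla, localNabla, assocCoord, map_add, covariant_add, map_add]
  rfl

lemma localNabla_smul (s : P.Sec U) (a : RSec T.A U) (y : (assoc P φ).Sec U) :
    c.localNabla s (a • y) = a • c.localNabla s y +
      toTensor (assoc P φ).toPreMod T.Ω.toPreMod (y ⊗ₜ T.d U a) := by
  rw [localNabla, localNabla, assocCoord, map_smul, covariant_smul, map_add, map_smul,
    toTensor_tmul_eq_frameForm P φ _ s]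
  rfl

lemma existsUnique_nabla (y : (assoc P φ).Sec U) :
    ∃! z : (tensor (assoc P φ).toPreMod T.Ω.toPreMod).Sec U,
      ∀ i : {i : Σ V : Opens X, P.Sec V // i.1 ≤ U},
        ares (tensor (assoc P φ).toPreMod T.Ω.toPreMod).ab i.2 z =
          c.localNabla i.1.2 ((assoc P φ).res i.2 y) := by
  refine ab_glue (tensor (assoc P φ).toPreMod T.Ω.toPreMod).isSheaf
    (ι := {i : Σ V : Opens X, P.Sec V // i.1 ≤ U}) (fun i => i.1.1) (fun i => i.2)
    (fun x hx => ?_) _ fun i j => ?_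
  · obtain ⟨V, hV, hxV, ⟨s⟩⟩ := P.exists_section hx
    exact ⟨⟨⟨V, s⟩, hV⟩, hxV⟩
  · refine (c.res_localNabla _ _ _).trans (Eq.trans ?_ (c.res_localNabla _ _ _).symm)
    rw [PreMod.res, PreMod.res, PreMod.res, ares_ares, ares_ares]
    exact c.localNabla_congr _ _ _

/-- The covariant derivative defined by connection matrices. -/
noncomputable def nabla (y : (assoc P φ).Sec U) :
    (tensor (assoc P φ).toPreMod T.Ω.toPreMod).Sec U :=
  (c.existsUnique_nabla y).choose

lemma res_nabla_eq {V : Opens X} (h : V ≤ U) (s : P.Sec V) (y : (assoc P φ).Sec U) :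
    (tensor (assoc P φ).toPreMod T.Ω.toPreMod).res h (c.nabla y) =
      c.localNabla s ((assoc P φ).res h y) :=
  (c.existsUnique_nabla y).choose_spec.1 ⟨⟨V, s⟩, h⟩

lemma nabla_add (y z : (assoc P φ).Sec U) : c.nabla (y + z) = c.nabla y + c.nabla z := by
  refine ShMod.ext_of_sections P fun V h s => ?_
  rw [map_add, c.res_nabla_eq h s, c.res_nabla_eq h s, c.res_nabla_eq h s, map_add,
    localNabla_add]

lemma nabla_smul (a : RSec T.A U) (y : (assoc P φ).Sec U) :
    c.nabla (a • y) = a • c.nabla y +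
      toTensor (assoc P φ).toPreMod T.Ω.toPreMod (y ⊗ₜ T.d U a) := by
  refine ShMod.ext_of_sections P fun V h s => ?_
  rw [map_add, c.res_nabla_eq h s, res_toTensor, tres_tmul, T.res_d]
  refine Eq.trans ?_ (congrArg (· + _) ((tensor (assoc P φ).toPreMod T.Ω.toPreMod).ares_smul h a
    (c.nabla y)).symm)
  refine (congrArg (c.localNabla s) ((assoc P φ).ares_smul h a y)).trans ?_
  rw [c.localNabla_smul, ← c.res_nabla_eq h s]

/-- The linear connection on the associated sheaf defined by connection matrices. -/
noncomputable def linearConnection : LinearConnection T (assoc P φ) where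
  nabla U := AddMonoidHom.mk' c.nabla c.nabla_add
  res_nabla {U V} h y := by
    change (tensor _ _).res h (c.nabla y) = c.nabla ((assoc P φ).res h y)
    refine ShMod.ext_of_sections P fun W k s => ?_
    rw [c.res_nabla_eq k s, PreMod.res, PreMod.res, PreMod.res, ares_ares, ares_ares]
    exact c.res_nabla_eq _ s _
  nabla_const _ a y := by
    change c.nabla _ = _ • c.nabla y
    -- `K`-linearity is the Leibniz rule for a constant, whose differential vanishes.
    rw [nabla_smul, Triad.d_algebraMap, TensorProduct.tmul_zero, map_zero, add_zero]
  leibniz _ a y := c.nabla_smul a y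

lemma isMatrix_linearConnection (s : P.Sec U) :
    c.linearConnection.IsMatrix (assocBasis P φ s) (c.θ U s) := by
  rw [LinearConnection.isMatrix_iff]
  intro j
  -- Since `s` is defined on all of `U`, the glued derivative is the local one in the frame of `s`,
  -- and `e_j` has constant coordinates there.
  have h := c.res_nabla_eq le_rfl s (assocBasis P φ s j)
  rw [PreMod.res, PreMod.res, ares_self, ares_self, localNabla] at h
  have e : assocCoord P φ s (assocBasis P φ s j) = Pi.single j 1 :=
    (assocMk P φ s).symm_apply_apply _
  rw [e, covariant_single] at h
  exact h

end ConnectionMatrices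

/-- The connection matrices of a linear connection on the associated sheaf. -/
noncomputable def LinearConnection.connectionMatrices (nb : LinearConnection T (assoc P φ)) :
    ConnectionMatrices P φ where
  θ _ s := (nb.existsUnique_isMatrix s).choose
  res_θ h s := (nb.existsUnique_isMatrix _).unique
    ((nb.existsUnique_isMatrix s).choose_spec.1.res h) (nb.existsUnique_isMatrix _).choose_spec.1
  θ_act _ s g := (nb.existsUnique_isMatrix _).unique
    (nb.existsUnique_isMatrix _).choose_spec.1 ((nb.existsUnique_isMatrix s).choose_spec.1.act g)

lemma LinearConnection.isMatrix_connectionMatrices (nb : LinearConnection T (assoc P φ))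
    (s : P.Sec U) : nb.IsMatrix (assocBasis P φ s) (nb.connectionMatrices.θ U s) :=
  (nb.existsUnique_isMatrix s).choose_spec.1

/-- Linear connections on the associated sheaf correspond to connection matrices. -/
noncomputable def linearEquiv : ConnectionMatrices P φ ≃ LinearConnection T (assoc P φ) where
  toFun c := c.linearConnection
  invFun nb := nb.connectionMatrices
  left_inv c := by
    ext U s : 3
    exact (c.linearConnection.existsUnique_isMatrix s).unique
      (c.linearConnection.isMatrix_connectionMatrices s) (c.isMatrix_linearConnection s)
  right_inv nb := LinearConnection.ext_of_isMatrix fun _ s =>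
    ⟨_, nb.connectionMatrices.isMatrix_linearConnection s, nb.isMatrix_connectionMatrices s⟩

end

end AssocSheaf

/-! ### The bijection and its uniqueness -/

theorem corollary1 {K : Type v} [RCLike K] {X : TopCat.{u}} (T : AssocSheaf.Triad K X)
    (𝒢 : AssocSheaf.LieTypeGroup T) (P : AssocSheaf.PrincipalSheaf 𝒢.G) (n : ℕ)
    (φ : AssocSheaf.Rep T.A 𝒢.G n) (φbar : AssocSheaf.LieMor 𝒢.L n)
    (hφ : AssocSheaf.IsLieType 𝒢 φ φbar)
    (hiso : ∀ U : Opens X, Function.Bijective (φbar.hom U)) :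
    ∃! F : AssocSheaf.PrincipalConnection P ≃
        AssocSheaf.LinearConnection T (AssocSheaf.assoc P φ),
      ∀ D : AssocSheaf.PrincipalConnection P, AssocSheaf.Induces φ φbar D (F D) := by
  have h : ∀ D : AssocSheaf.PrincipalConnection P, AssocSheaf.Induces φ φbar D
      (AssocSheaf.linearEquiv (AssocSheaf.principalEquiv P hφ hiso D)) := fun D U s =>
    ⟨_, (AssocSheaf.principalEquiv P hφ hiso D).isMatrix_linearConnection s,
      AssocSheaf.ofMatrix_principalEquiv hφ hiso D s⟩
  refine ⟨(AssocSheaf.principalEquiv P hφ hiso).trans AssocSheaf.linearEquiv, h, fun F hF => ?_⟩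
  refine Equiv.ext fun D => AssocSheaf.LinearConnection.ext_of_isMatrix fun U s => ?_
  obtain ⟨θ, hθ, e⟩ := hF D U s
  obtain ⟨θ', hθ', e'⟩ := h D U s
  -- Both matrices represent the form `(1 ⊗ φ̄)(D(s))`, so they coincide, and the two connections
  -- have the same matrix in every frame.
  obtain rfl := AssocSheaf.Triad.ofMatrix_bijective.1 (e.trans e'.symm)
  exact ⟨θ, hθ, hθ'⟩
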